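/- Let $A\in\mathbb R^{n\times n}$, $B\in\mathbb R^{n\times l}$, $E\in\mathbb R^{n\times m}$, $z,s\in\mathbb R^n$, $v\in\mathbb R^l$, $c\in\mathbb R$, let $(A,B)$ be stabilizable, and let $Q_1,Q_2\in\mathbb R^{n\times n}$, $R_1,R_2\in\mathbb R^{l\times l}$ be symmetric with $Q_1,Q_2,R_2\ge 0$ and $R_1>0$. Let $W(0),W(1),\dots$ be i.i.d. square-integrable $\mathbb R^m$-valued random variables on a probability space $(\Omega,\mathcal F,\mathbb P)$ with mean $\mu_W$. Put $f(x,u,w)=Ax+Bu+Ew+z$ and, for square-integrable $X$ and $U$, $$\ell(X,U)=\mathbb E\big[X^TQ_1X+U^TR_1U+s^TX+v^TU+c\big]+\mathrm{Tr}(Q_2\,\mathrm{Cov}(X))+\mathrm{Tr}(R_2\,\mathrm{Cov}(U)).$$ For a square-integrable initial value $X_0$ and a control process $U(\cdot)$ let $X_U(0)=X_0$, $X_U(k+1)=f(X_U(k),U(k),W(k))$ and $J_N(X_0,U)=\sum_{k=0}^{N-1}\ell(X_U(k),U(k))$. Control processes on the horizon $\{0,\dots,N-1\}$ are those with $U(k)$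 square-integrable and $W(k)$ independent of $X_U(k)$ and of $U(k)$ for all $k<N$. Assume that the equation $(I-A)x-Bu=E\mu_W+z$ of deterministic steady states has a solution and that $(A,Q_1^{1/2})$ is detectable. Then there exist: * a positive semidefinite solution $P$ of the Riccati equation $P=A^TPA+Q_1+Q_2-A^TPB[R_1+R_2+B^TPB]^{-1}B^TPA$; put $K=-[R_1+R_2+B^TPB]^{-1}B^TPA$; * a steady state $(x_e,u_e)$ that minimizes $x^TQ_1x+u^TR_1u+s^Tx+v^Tu+c$ among all solutions of the steady-state equation; * a probability measure $\varrho$ on $\mathbb R^n$ with finite second moment; * a continuous, strictly increasing, unbounded function $\alpha:[0,\infty)\to[0,\infty)$ with $\alpha(0)=0$; such that the following hold for the processes $(X^s_\star,U^s_\star)$ with $$X^s_\star(0)\sim\varrho,\quad U^s_\star(k)=K(X^s_\star(k)-x_e)+u_e,\quad X^s_\star(k+1)=f(X^s_\star(k),U^s_\star(k),W(k)),\quad W(k)\text{ independent of }X^s_\star(k)\quad(k\ge 0).$$ 1. Such processes exist on $\Omega$ whenever $\Omega$ carries a random variable uniformly distributed on $[0,1]$ and independent of the sequence $(W(k))_{k\ge0}$.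 2. Every such pair is stationary: the laws of $X^s_\star(k)$ and of $U^s_\star(k)$ have finite second moments and do not depend on $k$. The problem is strictly dissipative in $L^2$ at it with comparison function $\alpha$: there is a storage function $\lambda:\mathbb N_0\times L^2(\Omega;\mathbb R^n)\to\mathbb R$, bounded from below, with $$\ell(X,U)-\ell(X^s_\star(k),U^s_\star(k))+\lambda(k,X)-\lambda(k+1,f(X,U,W(k)))\ \ge\ \alpha\big(\mathbb E\|X-X^s_\star(k)\|^2\big)$$ for all $k$ and all square-integrable $X,U$ that are each independent of $W(k)$. 3. (Pathwise turnpike in probability.) For every such pair and every square-integrable $X_0$ there is a constant $C\in\mathbb R$ such that for all $N\in\mathbb N_0$, all $\delta>0$, all control processes $U(\cdot)$ with $J_N(X_0,U)\le\delta+\sum_{k=0}^{N-1}\ell(X^s_\star(k),U^s_\star(k))$ and all $\varepsilon,\eta>0$, $$\#\big\{k\in\{0,\dots,N-1\}\ \big|\ \mathbb P(\|X_U(k)-X^s_\star(k)\|\ge\varepsilon)\le\eta\big\}\ \ge\ N-\frac{\delta+C}{\alpha(\varepsilon^2\eta)}.$$ -/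

import Mathlib

open MeasureTheory ProbabilityTheory Matrix

noncomputable section

namespace StochLQ

/-- Data of a generalized stochastic linear-quadratic optimal control problem with state dimension
`n`, control dimension `l` and noise dimension `m`. -/
structure LQProblem (n l m : ℕ) where
  A : Matrix (Fin n) (Fin n) ℝ
  B : Matrix (Fin n) (Fin l) ℝ
  E : Matrix (Fin n) (Fin m) ℝ
  z : EuclideanSpace ℝ (Fin n)
  Q₁ : Matrix (Fin n) (Fin n) ℝ
  Q₂ : Matrix (Fin n) (Fin n) ℝ
  R₁ : Matrix (Fin l) (Fin l) ℝ
  R₂ : Matrix (Fin l) (Fin l) ℝ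
  s : EuclideanSpace ℝ (Fin n)
  v : EuclideanSpace ℝ (Fin l)
  c : ℝ

/-! ### Linear systems -/

/-- All complex eigenvalues lie in the open unit disc. -/
def IsSchurStable {n : ℕ} (M : Matrix (Fin n) (Fin n) ℝ) : Prop :=
  ∀ r ∈ spectrum ℂ (M.map (algebraMap ℝ ℂ)), ‖r‖ < 1

/-- `(A, B)` is stabilizable. -/
def IsStabilizable {n l : ℕ} (A : Matrix (Fin n) (Fin n) ℝ) (B : Matrix (Fin n) (Fin l) ℝ) : Prop :=
  ∃ F : Matrix (Fin l) (Fin n) ℝ, IsSchurStable (A + B * F)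

/-- `(A, C)` is detectable. -/
def IsDetectable {n q : ℕ} (A : Matrix (Fin n) (Fin n) ℝ) (C : Matrix (Fin q) (Fin n) ℝ) : Prop :=
  ∃ L : Matrix (Fin n) (Fin q) ℝ, IsSchurStable (A + L * C)

open scoped MatrixOrder in
/-- The positive semidefinite square root of a positive semidefinite matrix. -/
def psdSqrt {n : ℕ} (Q : Matrix (Fin n) (Fin n) ℝ) : Matrix (Fin n) (Fin n) ℝ :=
  CFC.sqrt Q

/-- Comparison functions of class `𝒦_∞` (only the values on `[0, ∞)` matter). -/
structure IsKInfty (α : ℝ → ℝ) : Prop where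
  continuousOn : ContinuousOn α (Set.Ici 0)
  strictMonoOn : StrictMonoOn α (Set.Ici 0)
  map_zero : α 0 = 0
  unbounded : ∀ M : ℝ, ∃ r : ℝ, 0 ≤ r ∧ M < α r

/-! ### Covariance matrices -/

/-- The covariance matrix of a random vector. -/
def covMatrix {Ω : Type*} [MeasurableSpace Ω] {d : ℕ} (μ : Measure Ω)
    (X : Ω → EuclideanSpace ℝ (Fin d)) : Matrix (Fin d) (Fin d) ℝ :=
  Matrix.of fun i j => covariance (fun ω => X ω i) (fun ω => X ω j) μ

namespace LQProblem

variable {n l m : ℕ} (p : LQProblem n l m)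

/-- The dynamics `f(x, u, w) = A x + B u + E w + z`. -/
def f (x : EuclideanSpace ℝ (Fin n)) (u : EuclideanSpace ℝ (Fin l))
    (w : EuclideanSpace ℝ (Fin m)) : EuclideanSpace ℝ (Fin n) :=
  toEuclideanLin p.A x + toEuclideanLin p.B u + toEuclideanLin p.E w + p.z

/-- The deterministic stage cost `xᵀ Q₁ x + uᵀ R₁ u + sᵀ x + vᵀ u + c`. -/
def detStageCost (x : EuclideanSpace ℝ (Fin n)) (u : EuclideanSpace ℝ (Fin l)) : ℝ :=
  inner ℝ x (toEuclideanLin p.Q₁ x) + inner ℝ u (toEuclideanLin p.R₁ u)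
    + inner ℝ p.s x + inner ℝ p.v u + p.c

/-- `(x, u)` is a steady state of the deterministic system with the noise replaced by its mean
`w`. -/
def IsSteadyState (w : EuclideanSpace ℝ (Fin m)) (x : EuclideanSpace ℝ (Fin n))
    (u : EuclideanSpace ℝ (Fin l)) : Prop :=
  x = p.f x u w

/-- `(x, u)` is a steady state of minimal deterministic stage cost. -/
def IsOptimalSteadyState (w : EuclideanSpace ℝ (Fin m)) (x : EuclideanSpace ℝ (Fin n))
    (u : EuclideanSpace ℝ (Fin l)) : Prop :=
  p.IsSteadyState w x u ∧
    ∀ x' u', p.IsSteadyState w x' u' → p.detStageCost x u ≤ p.detStageCost x' u'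

/-- `P` is a positive semidefinite solution of the discrete-time algebraic Riccati equation for the
weights `Q₁ + Q₂` and `R₁ + R₂`. -/
def IsRiccatiSolution (P : Matrix (Fin n) (Fin n) ℝ) : Prop :=
  P.PosSemidef ∧
    P = p.Aᵀ * P * p.A + (p.Q₁ + p.Q₂)
      - p.Aᵀ * P * p.B * ((p.R₁ + p.R₂) + p.Bᵀ * P * p.B)⁻¹ * p.Bᵀ * P * p.A

/-- The feedback gain `K = -[(R₁ + R₂) + Bᵀ P B]⁻¹ Bᵀ P A`. -/
def gain (P : Matrix (Fin n) (Fin n) ℝ) : Matrix (Fin l) (Fin n) ℝ :=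
  -(((p.R₁ + p.R₂) + p.Bᵀ * P * p.B)⁻¹ * p.Bᵀ * P * p.A)

variable {Ω : Type*} [MeasurableSpace Ω] (μ : Measure Ω) (W : ℕ → Ω → EuclideanSpace ℝ (Fin m))

/-- The stochastic stage cost. -/
def stageCost (X : Ω → EuclideanSpace ℝ (Fin n)) (U : Ω → EuclideanSpace ℝ (Fin l)) : ℝ :=
  (∫ ω, p.detStageCost (X ω) (U ω) ∂μ)
    + ((p.Q₂ * covMatrix μ X).trace + (p.R₂ * covMatrix μ U).trace)

/-- The state process `X_U(·, X₀)`. -/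
def traj (X₀ : Ω → EuclideanSpace ℝ (Fin n)) (U : ℕ → Ω → EuclideanSpace ℝ (Fin l)) :
    ℕ → Ω → EuclideanSpace ℝ (Fin n)
  | 0 => X₀
  | k + 1 => fun ω => p.f (traj X₀ U k ω) (U k ω) (W k ω)

/-- The cost `J_N(X₀, U) = ∑_{k < N} ℓ(X(k), U(k))`. -/
def cost (N : ℕ) (X₀ : Ω → EuclideanSpace ℝ (Fin n))
    (U : ℕ → Ω → EuclideanSpace ℝ (Fin l)) : ℝ :=
  ∑ k ∈ Finset.range N, p.stageCost μ (p.traj W X₀ U k) (U k)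

/-- Admissible control processes on the horizon `{0, …, N - 1}`: the controls are
square-integrable and `W k` is independent of the state and of the control at time `k`. If `X₀` is
independent of the noise sequence, this contains all square-integrable controls that are adapted
to the filtration `σ(X(0), …, X(k))` generated by the state process. -/
structure IsAdmissible (N : ℕ) (X₀ : Ω → EuclideanSpace ℝ (Fin n))
    (U : ℕ → Ω → EuclideanSpace ℝ (Fin l)) : Prop where
  memLp : ∀ k < N, MemLp (U k) 2 μ
  indep_state : ∀ k < N, IndepFun (p.traj W X₀ U k) (W k) μ
  indep_control : ∀ k < N, IndepFun (U k) (W k) μ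

/-- `ϱ` is a probability measure with finite second moment. -/
def _root_.StochLQ.IsP2 {d : ℕ} (ϱ : Measure (EuclideanSpace ℝ (Fin d))) : Prop :=
  IsProbabilityMeasure ϱ ∧ ∫⁻ x, ‖x‖ₑ ^ 2 ∂ϱ < ⊤

/-- Stationary pairs of state and control processes for the noise sequence `W`. As for every state
and control process of the system, `W k` is independent of the state and control at time `k`. -/
def IsStationaryPair (Xs : ℕ → Ω → EuclideanSpace ℝ (Fin n))
    (Us : ℕ → Ω → EuclideanSpace ℝ (Fin l)) : Prop :=
  ∃ (ϱX : Measure (EuclideanSpace ℝ (Fin n))) (ϱU : Measure (EuclideanSpace ℝ (Fin l))),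
    IsP2 ϱX ∧ IsP2 ϱU ∧
    ∀ k, HasLaw (Xs k) ϱX μ ∧ HasLaw (Us k) ϱU μ ∧
      IndepFun (Xs k) (W k) μ ∧ IndepFun (Us k) (W k) μ ∧
      Xs (k + 1) =ᵐ[μ] fun ω => p.f (Xs k ω) (Us k ω) (W k ω)

/-- The problem is strictly dissipative in `L²` at `(Xs, Us)` with the comparison function `α`: there
is a time-varying storage function `stor` on `L²` (a function of random vectors that respects
almost sure equality), uniformly bounded from below, satisfying the dissipation inequality for all
square-integrable `X`, `U` that are independent of `W k`. -/
def IsStrictlyDissipativeWith (Xs : ℕ → Ω → EuclideanSpace ℝ (Fin n))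
    (Us : ℕ → Ω → EuclideanSpace ℝ (Fin l)) (α : ℝ → ℝ) : Prop :=
  IsKInfty α ∧
  ∃ stor : ℕ → (Ω → EuclideanSpace ℝ (Fin n)) → ℝ,
    (∀ k X Y, X =ᵐ[μ] Y → stor k X = stor k Y) ∧
    (∃ M : ℝ, ∀ k X, MemLp X 2 μ → M ≤ stor k X) ∧
    ∀ (k : ℕ) (X : Ω → EuclideanSpace ℝ (Fin n)) (U : Ω → EuclideanSpace ℝ (Fin l)),
      MemLp X 2 μ → MemLp U 2 μ → IndepFun X (W k) μ → IndepFun U (W k) μ →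
      α (∫ ω, ‖X ω - Xs k ω‖ ^ 2 ∂μ) ≤
        p.stageCost μ X U - p.stageCost μ (Xs k) (Us k)
          + stor k X - stor (k + 1) (fun ω => p.f (X ω) (U ω) (W k ω))

/-- `(Xs, Us)` is a solution of the system under the affine feedback
`U = K (X - xe) + ue`, started with the law `ϱ`, and `W k` is independent of the state at
time `k`. -/
structure IsFeedbackSolution (K : Matrix (Fin l) (Fin n) ℝ) (xe : EuclideanSpace ℝ (Fin n))
    (ue : EuclideanSpace ℝ (Fin l)) (ϱ : Measure (EuclideanSpace ℝ (Fin n)))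
    (Xs : ℕ → Ω → EuclideanSpace ℝ (Fin n)) (Us : ℕ → Ω → EuclideanSpace ℝ (Fin l)) : Prop where
  law_zero : HasLaw (Xs 0) ϱ μ
  indep : ∀ k, IndepFun (Xs k) (W k) μ
  feedback : ∀ k, Us k =ᵐ[μ] fun ω => toEuclideanLin K (Xs k ω - xe) + ue
  step : ∀ k, Xs (k + 1) =ᵐ[μ] fun ω => p.f (Xs k ω) (Us k ω) (W k ω)

open Classical in
/-- The number `𝒮_{ε,η}` of times `k < N` with `ℙ(‖X k - Xs k‖ ≥ ε) ≤ η`. -/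
def _root_.StochLQ.turnpikeCount {d : ℕ} (X Xs : ℕ → Ω → EuclideanSpace ℝ (Fin d)) (N : ℕ)
    (ε η : ℝ) : ℕ :=
  ((Finset.range N).filter fun k => μ.real {ω | ε ≤ ‖X k ω - Xs k ω‖} ≤ η).card

end LQProblem

end StochLQ

end

/-!
Detectability of `(A, Q₁^{1/2})` yields, by output injection, a positive definite quadratic form `S`
that is a strict storage function of the deterministic homogeneous problem; the Lagrange multiplier
`ν` of the steady-state problem and the Riccati solution `P` extend it to the stochastic problem.
With `d = X - Xs k` and `y = Xs k - xe`, the storage function is the expectation of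
`ν ⬝ d - 2 dᵀ P y + dᵀ S d`. The linear terms that the quadratic costs produce around `Xs k` are
exactly compensated: those in `xe` and `ue` by `ν` and those in `y` by the Riccati equation, while
the noise only enters through `dᵀ P E (W k - E[W k])`, whose mean vanishes by independence. What
remains is `S`-dissipativity with a rate proportional to `E‖d‖²`.

The form `P + S` is a Lyapunov function of the closed loop, so the closed loop is a contraction up
to a constant, and the stationary law is the law of the series of past noise terms propagated by
it. Summing the dissipation inequality bounds the sum of `α (E‖X k - Xs k‖²)`; by Markov's
inequality every time at which `X k` is far from `Xs k` contributes at least `α (ε² η)` to it.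
-/

namespace StochLQ

open Filter Topology
open scoped RealInnerProductSpace MatrixOrder

local notation "⟪" x "," y "⟫[" M "]" => inner ℝ x (toEuclideanLin M y)

section QuadraticForms

variable {k l m n : Type*}

lemma transpose_mul_mul_mono [Fintype m] [Finite n] {M N : Matrix m m ℝ} (h : M ≤ N)
    (T : Matrix m n ℝ) : Tᵀ * M * T ≤ Tᵀ * N * T := by
  rw [Matrix.le_iff] at h ⊢
  simpa only [conjTranspose_eq_transpose_of_trivial, Matrix.mul_sub, Matrix.sub_mul] using
    h.conjTranspose_mul_mul_same T

lemma posDef_of_smul_one_le [Finite n] [DecidableEq n] {M : Matrix n n ℝ} {c : ℝ} (hc : 0 < c)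
    (h : c • (1 : Matrix n n ℝ) ≤ M) : M.PosDef := by
  simpa using (Matrix.PosDef.one.smul hc).add_posSemidef (Matrix.le_iff.1 h)

variable [Fintype n] [DecidableEq n]

lemma toEuclideanLin_mul_apply [Fintype l] [DecidableEq l] (M : Matrix m n ℝ) (N : Matrix n l ℝ)
    (x : EuclideanSpace ℝ l) :
    toEuclideanLin (M * N) x = toEuclideanLin M (toEuclideanLin N x) := by
  rw [toLpLin_mul_same, LinearMap.comp_apply]

lemma toEuclideanLin_one_apply (x : EuclideanSpace ℝ n) :
    toEuclideanLin (1 : Matrix n n ℝ) x = x := by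
  rw [toLpLin_one, LinearMap.id_apply]

lemma inner_toEuclideanLin_transpose [Fintype m] [DecidableEq m] (M : Matrix m n ℝ)
    (x : EuclideanSpace ℝ n) (y : EuclideanSpace ℝ m) : ⟪x, y⟫[Mᵀ] = ⟪toEuclideanLin M x, y⟫ := by
  rw [← conjTranspose_eq_transpose_of_trivial, toEuclideanLin_conjTranspose_eq_adjoint,
    LinearMap.adjoint_inner_right]

lemma inner_toEuclideanLin_transpose_mul_mul [Fintype m] [Fintype k] [DecidableEq k] [Fintype l]
    [DecidableEq l] (T : Matrix m n ℝ) (M : Matrix m k ℝ) (N : Matrix k l ℝ)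
    (x : EuclideanSpace ℝ n) (y : EuclideanSpace ℝ l) :
    ⟪x, y⟫[Tᵀ * M * N] = ⟪toEuclideanLin T x, toEuclideanLin N y⟫[M] := by
  classical
  rw [Matrix.mul_assoc, toEuclideanLin_mul_apply, inner_toEuclideanLin_transpose,
    toEuclideanLin_mul_apply]

lemma inner_toEuclideanLin_transpose_mul_self [Fintype m] (M : Matrix m n ℝ)
    (x : EuclideanSpace ℝ n) : ⟪x, x⟫[Mᵀ * M] = ‖toEuclideanLin M x‖ ^ 2 := by
  classical
  rw [toEuclideanLin_mul_apply, inner_toEuclideanLin_transpose, real_inner_self_eq_norm_sq]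

lemma inner_toEuclideanLin_smul [Fintype m] (c : ℝ) (M : Matrix m n ℝ)
    (x : EuclideanSpace ℝ m) (y : EuclideanSpace ℝ n) : ⟪x, y⟫[c • M] = c * ⟪x, y⟫[M] := by
  rw [map_smul, LinearMap.smul_apply, real_inner_smul_right]

lemma inner_toEuclideanLin_smul_one (c : ℝ) (x : EuclideanSpace ℝ n) :
    ⟪x, x⟫[c • (1 : Matrix n n ℝ)] = c * ‖x‖ ^ 2 := by
  rw [inner_toEuclideanLin_smul, toEuclideanLin_one_apply, real_inner_self_eq_norm_sq]

lemma inner_toEuclideanLin_comm {M : Matrix n n ℝ} (hM : M.IsHermitian)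
    (x y : EuclideanSpace ℝ n) : ⟪x, y⟫[M] = ⟪y, x⟫[M] := by
  rw [← isSymmetric_toEuclideanLin_iff.2 hM x y, real_inner_comm]

lemma posSemidef_iff_inner_nonneg {M : Matrix n n ℝ} (hM : M.IsHermitian) :
    M.PosSemidef ↔ ∀ x, 0 ≤ ⟪x, x⟫[M] := by
  rw [← isPositive_toEuclideanLin_iff, LinearMap.IsPositive]
  simp only [isSymmetric_toEuclideanLin_iff.2 hM, true_and, RCLike.re_to_real]
  exact forall_congr' fun x => by rw [real_inner_comm]

lemma inner_toEuclideanLin_nonneg {M : Matrix n n ℝ} (hM : M.PosSemidef)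
    (x : EuclideanSpace ℝ n) : 0 ≤ ⟪x, x⟫[M] :=
  (posSemidef_iff_inner_nonneg hM.1).1 hM x

lemma le_iff_inner_le {M N : Matrix n n ℝ} (hM : M.IsHermitian) (hN : N.IsHermitian) :
    M ≤ N ↔ ∀ x, ⟪x, x⟫[M] ≤ ⟪x, x⟫[N] := by
  simp only [Matrix.le_iff, posSemidef_iff_inner_nonneg (hN.sub hM), map_sub,
    LinearMap.sub_apply, inner_sub_right, sub_nonneg]

lemma inner_toEuclideanLin_mono {M N : Matrix n n ℝ} (h : M ≤ N) (x : EuclideanSpace ℝ n) :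
    ⟪x, x⟫[M] ≤ ⟪x, x⟫[N] := by
  simpa only [map_sub, LinearMap.sub_apply, inner_sub_right, sub_nonneg] using
    inner_toEuclideanLin_nonneg (Matrix.le_iff.1 h) x

open scoped Matrix.Norms.L2Operator in
lemma norm_toEuclideanLin_le [Fintype m] (M : Matrix m n ℝ) (x : EuclideanSpace ℝ n) :
    ‖toEuclideanLin M x‖ ≤ ‖M‖ * ‖x‖ :=
  l2_opNorm_mulVec M x

open scoped Matrix.Norms.L2Operator in
lemma inner_toEuclideanLin_le_norm (M : Matrix n n ℝ) (x : EuclideanSpace ℝ n) :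
    ⟪x, x⟫[M] ≤ ‖M‖ * ‖x‖ ^ 2 :=
  calc ⟪x, x⟫[M] ≤ ‖x‖ * ‖toEuclideanLin M x‖ := real_inner_le_norm _ _
    _ ≤ ‖x‖ * (‖M‖ * ‖x‖) := by gcongr; exact norm_toEuclideanLin_le M x
    _ = ‖M‖ * ‖x‖ ^ 2 := by ring

lemma exists_pos_mul_norm_sq_le {M : Matrix n n ℝ} (hM : M.PosDef) :
    ∃ c > 0, ∀ x, c * ‖x‖ ^ 2 ≤ ⟪x, x⟫[M] := by
  cases isEmpty_or_nonempty n
  · exact ⟨1, one_pos, fun x => by simp [Subsingleton.elim x 0]⟩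
  obtain ⟨c, hc, h⟩ := (CFC.exists_pos_algebraMap_le_iff hM.1.isSelfAdjoint).2
    fun x hx => hM.isStrictlyPositive.spectrum_pos hx
  refine ⟨c, hc, fun x => ?_⟩
  rw [← inner_toEuclideanLin_smul_one, ← Algebra.algebraMap_eq_smul_one]
  exact inner_toEuclideanLin_mono h x

open scoped Matrix.Norms.L2Operator in
omit [Fintype n] [DecidableEq n] in
lemma exists_one_le_le_smul [Finite n] {G D : Matrix n n ℝ} (hG : G.IsHermitian) (hD : D.PosDef) :
    ∃ t : ℝ, 1 ≤ t ∧ G ≤ t • D := by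
  classical
  have := Fintype.ofFinite n
  obtain ⟨c, hc, hcD⟩ := exists_pos_mul_norm_sq_le hD
  refine ⟨1 + ‖G‖ / c, by linarith [show 0 ≤ ‖G‖ / c by positivity],
    (le_iff_inner_le hG (hD.1.smul (.all _))).2 fun x => ?_⟩
  calc ⟪x, x⟫[G] ≤ ‖G‖ / c * (c * ‖x‖ ^ 2) := by
        rw [← mul_assoc, div_mul_cancel₀ _ hc.ne']; exact inner_toEuclideanLin_le_norm G x
    _ ≤ ‖G‖ / c * ⟪x, x⟫[D] := by gcongr; exact hcD x
    _ ≤ (1 + ‖G‖ / c) * ⟪x, x⟫[D] := by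
        gcongr
        exacts [inner_toEuclideanLin_nonneg hD.posSemidef x, by linarith]
    _ = ⟪x, x⟫[(1 + ‖G‖ / c) • D] := (inner_toEuclideanLin_smul _ _ _ _).symm

lemma two_mul_inner_toEuclideanLin_le {S : Matrix n n ℝ} (hS : S.PosSemidef) {ε : ℝ} (hε : 0 < ε)
    (a b : EuclideanSpace ℝ n) : 2 * ⟪a, b⟫[S] ≤ ε * ⟪a, a⟫[S] + ε⁻¹ * ⟪b, b⟫[S] := by
  have h := mul_nonneg (inv_nonneg.2 hε.le) (inner_toEuclideanLin_nonneg hS (ε • a - b))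
  have hexpand : ⟪ε • a - b, ε • a - b⟫[S] =
      ε * (ε * ⟪a, a⟫[S]) - ε * (2 * ⟪a, b⟫[S]) + ⟪b, b⟫[S] := by
    simp only [map_sub, map_smul, inner_sub_left, inner_sub_right, real_inner_smul_left,
      real_inner_smul_right, inner_toEuclideanLin_comm hS.1 b a]
    ring
  rw [hexpand, mul_add, mul_sub, inv_mul_cancel_left₀ hε.ne', inv_mul_cancel_left₀ hε.ne'] at h
  linarith

lemma inner_toEuclideanLin_add_add {S : Matrix n n ℝ} (hS : S.IsHermitian)
    (a b : EuclideanSpace ℝ n) :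
    ⟪a + b, a + b⟫[S] = ⟪a, a⟫[S] + 2 * ⟪a, b⟫[S] + ⟪b, b⟫[S] := by
  rw [map_add, inner_add_left, inner_add_right, inner_add_right, inner_toEuclideanLin_comm hS b a]
  ring

end QuadraticForms

section Lyapunov

lemma tendsto_pow_of_spectralRadius_lt_one {𝓐 : Type*} [NormedRing 𝓐] [NormedAlgebra ℂ 𝓐]
    [CompleteSpace 𝓐] {a : 𝓐} (ha : spectralRadius ℂ a < 1) :
    Tendsto (fun k : ℕ => a ^ k) atTop (𝓝 0) := by
  obtain ⟨r, hr, hr1⟩ := ENNReal.lt_iff_exists_nnreal_btwn.1 ha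
  have hle : ∀ᶠ k : ℕ in atTop, ‖a ^ k‖ ≤ (r : ℝ) ^ k := by
    filter_upwards [(spectrum.pow_nnnorm_pow_one_div_tendsto_nhds_spectralRadius
      a).eventually_lt_const hr, eventually_ne_atTop 0] with k hk hk0
    have hpow : ((‖a ^ k‖₊ : ENNReal) ^ (1 / k : ℝ)) ^ k ≤ (r : ENNReal) ^ k := by gcongr
    rw [one_div, ENNReal.rpow_inv_natCast_pow hk0] at hpow
    exact_mod_cast hpow
  exact squeeze_zero_norm' hle (tendsto_pow_atTop_nhds_zero_of_lt_one r.2 (by exact_mod_cast hr1))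

lemma IsSchurStable.tendsto_pow {n : ℕ} {M : Matrix (Fin n) (Fin n) ℝ} (hM : IsSchurStable M) :
    Tendsto (fun k : ℕ => M ^ k) atTop (𝓝 0) := by
  cases isEmpty_or_nonempty (Fin n)
  · simpa only [Subsingleton.elim _ (0 : Matrix (Fin n) (Fin n) ℝ)] using tendsto_const_nhds
  let : NormedRing (Matrix (Fin n) (Fin n) ℂ) := Matrix.linftyOpNormedRing
  let : NormedAlgebra ℂ (Matrix (Fin n) (Fin n) ℂ) := Matrix.linftyOpNormedAlgebra
  have hpow : Tendsto (fun k : ℕ => M.map (algebraMap ℝ ℂ) ^ k) atTop (𝓝 0) :=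
    tendsto_pow_of_spectralRadius_lt_one <|
      spectrum.spectralRadius_lt_of_forall_lt (r := 1) _ fun r hr => hM r hr
  have hre : Continuous fun N : Matrix (Fin n) (Fin n) ℂ => N.map Complex.re :=
    continuous_id.matrix_map Complex.continuous_re
  have hmap : ∀ k : ℕ, (M.map (algebraMap ℝ ℂ) ^ k).map Complex.re = M ^ k := fun k => by
    rw [← RingHom.mapMatrix_apply, ← map_pow, RingHom.mapMatrix_apply, Matrix.map_map]
    exact Matrix.map_id _
  simpa only [Function.comp_def, hmap, Matrix.map_zero _ Complex.zero_re] using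
    (hre.tendsto 0).comp hpow

variable {n : Type*} [Fintype n]

/-- The quadratic form of `S` is a strict Lyapunov function of the linear system `x ↦ M x`. -/
structure IsLyapunov (M S : Matrix n n ℝ) : Prop where
  posDef : S.PosDef
  posDef_decrease : (S - Mᵀ * S * M).PosDef

lemma IsLyapunov.of_posSemidef {M S : Matrix n n ℝ} (hS : S.PosSemidef)
    (hMS : (S - Mᵀ * S * M).PosDef) : IsLyapunov M S where
  posDef := by
    simpa only [conjTranspose_eq_transpose_of_trivial, sub_add_cancel] using
      hMS.add_posSemidef (hS.conjTranspose_mul_mul_same M)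
  posDef_decrease := hMS

variable [DecidableEq n]

open scoped Matrix.Norms.L2Operator in
lemma posDef_one_sub_transpose_mul_self {N : Matrix n n ℝ} (hN : ‖N‖ < 1) :
    (1 - Nᵀ * N).PosDef := by
  have hNN : (Nᵀ * N).IsHermitian := isHermitian_conjTranspose_mul_self N
  have hgap : 0 < 1 - ‖N‖ ^ 2 := sub_pos.2 (pow_lt_one₀ (norm_nonneg _) hN two_ne_zero)
  refine posDef_of_smul_one_le hgap ((le_iff_inner_le (isHermitian_one.smul (.all _))
    (isHermitian_one.sub hNN)).2 fun x => ?_)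
  have hbound : ‖toEuclideanLin N x‖ ^ 2 ≤ ‖N‖ ^ 2 * ‖x‖ ^ 2 := by
    rw [← mul_pow]; gcongr; exact norm_toEuclideanLin_le N x
  rw [inner_toEuclideanLin_smul_one, map_sub, LinearMap.sub_apply, inner_sub_right,
    inner_toEuclideanLin_transpose_mul_self, toEuclideanLin_one_apply, real_inner_self_eq_norm_sq]
  linarith

lemma sum_transpose_pow_mul_pow_sub (M : Matrix n n ℝ) (k : ℕ) :
    ∑ j ∈ Finset.range k, (M ^ j)ᵀ * M ^ j - Mᵀ * (∑ j ∈ Finset.range k, (M ^ j)ᵀ * M ^ j) * M =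
      1 - (M ^ k)ᵀ * M ^ k := by
  have hshift : ∀ j, Mᵀ * ((M ^ j)ᵀ * M ^ j) * M = (M ^ (j + 1))ᵀ * M ^ (j + 1) := fun j => by
    rw [pow_succ, transpose_mul]; simp only [Matrix.mul_assoc]
  rw [Finset.mul_sum, Finset.sum_mul, Finset.sum_congr rfl fun j _ => hshift j,
    ← Finset.sum_sub_distrib, Finset.sum_range_sub']
  simp only [pow_zero, transpose_one, one_mul]

open scoped Matrix.Norms.L2Operator in
lemma exists_isLyapunov_of_tendsto_pow {M : Matrix n n ℝ}
    (hM : Tendsto (fun k : ℕ => M ^ k) atTop (𝓝 0)) : ∃ S, IsLyapunov M S := by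
  obtain ⟨k, hk⟩ : ∃ k : ℕ, ‖M ^ k‖ < 1 :=
    ((tendsto_zero_iff_norm_tendsto_zero.1 hM).eventually_lt_const one_pos).exists
  refine ⟨∑ j ∈ Finset.range k, (M ^ j)ᵀ * M ^ j, .of_posSemidef ?_ ?_⟩
  · exact posSemidef_sum _ fun j _ => posSemidef_conjTranspose_mul_self (M ^ j)
  · rw [sum_transpose_pow_mul_pow_sub]
    exact posDef_one_sub_transpose_mul_self hk

namespace IsLyapunov

variable {M S : Matrix n n ℝ}

omit [DecidableEq n] in
lemma exists_transpose_mul_mul_le (h : IsLyapunov M S) :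
    ∃ ρ : ℝ, 0 ≤ ρ ∧ ρ < 1 ∧ Mᵀ * S * M ≤ ρ • S := by
  obtain ⟨t, ht, hSt⟩ := exists_one_le_le_smul h.posDef.1 h.posDef_decrease
  have ht0 : 0 < t := one_pos.trans_le ht
  refine ⟨1 - t⁻¹, sub_nonneg.2 (inv_le_one_of_one_le₀ ht), by simpa using ht0, ?_⟩
  have hinv : t⁻¹ • S ≤ S - Mᵀ * S * M := by
    simpa only [inv_smul_smul₀ ht0.ne'] using smul_le_smul_of_nonneg_left hSt (inv_nonneg.2 ht0.le)
  rw [sub_smul, one_smul]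
  exact le_sub_comm.1 hinv

lemma transpose_pow_mul_mul_pow_le {ρ : ℝ} (hρ : 0 ≤ ρ)
    (h : Mᵀ * S * M ≤ ρ • S) (k : ℕ) : (M ^ k)ᵀ * S * M ^ k ≤ ρ ^ k • S := by
  induction k with
  | zero => simp
  | succ k ih =>
    calc (M ^ (k + 1))ᵀ * S * M ^ (k + 1) = Mᵀ * ((M ^ k)ᵀ * S * M ^ k) * M := by
          rw [pow_succ, transpose_mul]; simp only [Matrix.mul_assoc]
      _ ≤ Mᵀ * (ρ ^ k • S) * M := transpose_mul_mul_mono ih M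
      _ = ρ ^ k • (Mᵀ * S * M) := by rw [Matrix.mul_smul, Matrix.smul_mul]
      _ ≤ ρ ^ k • (ρ • S) := smul_le_smul_of_nonneg_left h (by positivity)
      _ = ρ ^ (k + 1) • S := by rw [smul_smul, pow_succ]

open scoped Matrix.Norms.L2Operator in
lemma summable_norm_pow (h : IsLyapunov M S) : Summable fun k : ℕ => ‖M ^ k‖ := by
  obtain ⟨ρ, hρ0, hρ1, hρ⟩ := h.exists_transpose_mul_mul_le
  obtain ⟨c, hc, hcS⟩ := exists_pos_mul_norm_sq_le h.posDef
  have hbound : ∀ k : ℕ, ‖M ^ k‖ ≤ √(‖S‖ / c) * √ρ ^ k := fun k =>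
    ContinuousLinearMap.opNorm_le_bound _ (by positivity) fun x => by
      refine le_of_sq_le_sq ?_ (by positivity)
      have hchain : c * ‖toEuclideanLin (M ^ k) x‖ ^ 2 ≤ ρ ^ k * (‖S‖ * ‖x‖ ^ 2) :=
        calc c * ‖toEuclideanLin (M ^ k) x‖ ^ 2
            ≤ ⟪toEuclideanLin (M ^ k) x, toEuclideanLin (M ^ k) x⟫[S] := hcS _
          _ = ⟪x, x⟫[(M ^ k)ᵀ * S * M ^ k] := (inner_toEuclideanLin_transpose_mul_mul ..).symm
          _ ≤ ⟪x, x⟫[ρ ^ k • S] :=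
            inner_toEuclideanLin_mono (transpose_pow_mul_mul_pow_le hρ0 hρ k) x
          _ = ρ ^ k * ⟪x, x⟫[S] := inner_toEuclideanLin_smul _ _ _ _
          _ ≤ ρ ^ k * (‖S‖ * ‖x‖ ^ 2) := by gcongr; exact inner_toEuclideanLin_le_norm S x
      calc ‖toEuclideanLin (M ^ k) x‖ ^ 2 ≤ ρ ^ k * (‖S‖ * ‖x‖ ^ 2) / c := by
            rwa [le_div_iff₀' hc]
        _ = (√(‖S‖ / c) * √ρ ^ k * ‖x‖) ^ 2 := by
          rw [mul_pow, mul_pow, ← pow_mul, mul_comm k 2, pow_mul, Real.sq_sqrt hρ0,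
            Real.sq_sqrt (by positivity)]
          ring
  exact .of_nonneg_of_le (fun _ => norm_nonneg _) hbound <|
    (summable_geometric_of_lt_one (Real.sqrt_nonneg _)
      ((Real.sqrt_lt' one_pos).2 (by simpa using hρ1))).mul_left _

end IsLyapunov

end Lyapunov

section Detectability

variable {n l q : Type*} [Fintype n] [DecidableEq n] [Fintype l] [DecidableEq l]

open scoped Matrix.Norms.L2Operator in
lemma IsLyapunov.exists_disturbance_bound {M S : Matrix n n ℝ} (h : IsLyapunov M S) :
    ∃ c > 0, ∃ γ ≥ 0, ∀ x d : EuclideanSpace ℝ n,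
      ⟪toEuclideanLin M x + d, toEuclideanLin M x + d⟫[S] ≤
        ⟪x, x⟫[S] - c * ‖x‖ ^ 2 + γ * ‖d‖ ^ 2 := by
  have hS := h.posDef.posSemidef
  obtain ⟨c, hc, hcD⟩ := exists_pos_mul_norm_sq_le h.posDef_decrease
  obtain ⟨t, ht, htD⟩ :=
    exists_one_le_le_smul (hS.conjTranspose_mul_mul_same M).1 h.posDef_decrease
  have ht0 : 0 < 2 * t := by linarith
  refine ⟨c / 2, half_pos hc, (1 + 2 * t) * ‖S‖, by positivity, fun x d => ?_⟩
  set a := toEuclideanLin M x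
  have ha : ⟪a, a⟫[S] = ⟪x, x⟫[S] - ⟪x, x⟫[S - Mᵀ * S * M] := by
    rw [map_sub, LinearMap.sub_apply, inner_sub_right, inner_toEuclideanLin_transpose_mul_mul]
    ring
  have hat : ⟪a, a⟫[S] ≤ t * ⟪x, x⟫[S - Mᵀ * S * M] := by
    rw [← inner_toEuclideanLin_transpose_mul_mul, ← inner_toEuclideanLin_smul]
    exact inner_toEuclideanLin_mono htD x
  have hyoung := two_mul_inner_toEuclideanLin_le hS (inv_pos.2 ht0) a d
  have hscale : (2 * t)⁻¹ * ⟪a, a⟫[S] ≤ 2⁻¹ * ⟪x, x⟫[S - Mᵀ * S * M] := by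
    rw [inv_mul_le_iff₀ ht0]; linarith
  have hd : (1 + 2 * t) * ⟪d, d⟫[S] ≤ (1 + 2 * t) * (‖S‖ * ‖d‖ ^ 2) := by
    gcongr; exact inner_toEuclideanLin_le_norm S d
  rw [inner_toEuclideanLin_add_add hS.1]
  rw [inv_inv] at hyoung
  linarith [hcD x]

/-- `x ↦ xᵀ S x` is a storage function with which the system `x⁺ = A x + B u` is strictly
dissipative in the state, with supply rate `xᵀ Q x + uᵀ R u` and rate `c ‖x‖²`. -/
structure IsStrictStorage (A : Matrix n n ℝ) (B : Matrix n l ℝ) (Q : Matrix n n ℝ)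
    (R : Matrix l l ℝ) (S : Matrix n n ℝ) (c : ℝ) : Prop where
  posDef : S.PosDef
  rate_pos : 0 < c
  le_supply : ∀ x u, c * ‖x‖ ^ 2 ≤ ⟪x, x⟫[Q] + ⟪u, u⟫[R] + ⟪x, x⟫[S]
    - ⟪toEuclideanLin A x + toEuclideanLin B u, toEuclideanLin A x + toEuclideanLin B u⟫[S]

omit [DecidableEq n] in
open scoped Matrix.Norms.L2Operator in
lemma exists_norm_sub_sq_le [Fintype q] [DecidableEq q] (B : Matrix n l ℝ) (G : Matrix n q ℝ)
    {R : Matrix l l ℝ} (hR : R.PosDef) :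
    ∃ κ ≥ 0, ∀ u y, ‖toEuclideanLin B u - toEuclideanLin G y‖ ^ 2 ≤ κ * (‖y‖ ^ 2 + ⟪u, u⟫[R]) := by
  obtain ⟨r, hr, hrR⟩ := exists_pos_mul_norm_sq_le hR
  refine ⟨2 * ‖B‖ ^ 2 / r + 2 * ‖G‖ ^ 2, by positivity, fun u y => ?_⟩
  have hu : ‖u‖ ^ 2 ≤ ⟪u, u⟫[R] / r := by rw [le_div_iff₀' hr]; exact hrR u
  have hR0 : 0 ≤ ⟪u, u⟫[R] := inner_toEuclideanLin_nonneg hR.posSemidef u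
  calc ‖toEuclideanLin B u - toEuclideanLin G y‖ ^ 2
      ≤ (‖B‖ * ‖u‖ + ‖G‖ * ‖y‖) ^ 2 := by
        gcongr
        exact (norm_sub_le _ _).trans
          (add_le_add (norm_toEuclideanLin_le B u) (norm_toEuclideanLin_le G y))
    _ ≤ 2 * ((‖B‖ * ‖u‖) ^ 2 + (‖G‖ * ‖y‖) ^ 2) := add_sq_le
    _ = 2 * ‖B‖ ^ 2 * ‖u‖ ^ 2 + 2 * ‖G‖ ^ 2 * ‖y‖ ^ 2 := by ring
    _ ≤ 2 * ‖B‖ ^ 2 * (⟪u, u⟫[R] / r) + 2 * ‖G‖ ^ 2 * ‖y‖ ^ 2 := by gcongr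
    _ = 2 * ‖B‖ ^ 2 / r * ⟪u, u⟫[R] + 2 * ‖G‖ ^ 2 * ‖y‖ ^ 2 := by ring
    _ ≤ (2 * ‖B‖ ^ 2 / r + 2 * ‖G‖ ^ 2) * ⟪u, u⟫[R] +
          (2 * ‖B‖ ^ 2 / r + 2 * ‖G‖ ^ 2) * ‖y‖ ^ 2 := by
        gcongr
        exacts [le_add_of_nonneg_right (by positivity), le_add_of_nonneg_left (by positivity)]
    _ = (2 * ‖B‖ ^ 2 / r + 2 * ‖G‖ ^ 2) * (‖y‖ ^ 2 + ⟪u, u⟫[R]) := by ring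

/- Output injection writes `A x + B u = (A + G C) x + d` with `d = B u - G C x`, and `‖d‖²` is
controlled by the supply rate. -/
lemma IsLyapunov.exists_isStrictStorage [Fintype q] {A : Matrix n n ℝ} {B : Matrix n l ℝ}
    {C : Matrix q n ℝ} {R : Matrix l l ℝ} {G : Matrix n q ℝ} {S : Matrix n n ℝ}
    (hS : IsLyapunov (A + G * C) S) (hR : R.PosDef) :
    ∃ S' c, IsStrictStorage A B (Cᵀ * C) R S' c := by
  classical
  obtain ⟨c, hc, γ, hγ, hdist⟩ := hS.exists_disturbance_bound
  obtain ⟨κ, hκ, hd⟩ := exists_norm_sub_sq_le B G hR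
  have hδ : 0 < (1 + γ * κ)⁻¹ := by positivity
  refine ⟨(1 + γ * κ)⁻¹ • S, (1 + γ * κ)⁻¹ * c, hS.posDef.smul hδ, by positivity, fun x u => ?_⟩
  set d := toEuclideanLin B u - toEuclideanLin G (toEuclideanLin C x)
  have hnext : toEuclideanLin A x + toEuclideanLin B u = toEuclideanLin (A + G * C) x + d := by
    simp only [d, map_add, LinearMap.add_apply, toEuclideanLin_mul_apply, add_assoc,
      add_sub_cancel]
  have hsupply : 0 ≤ ⟪x, x⟫[Cᵀ * C] + ⟪u, u⟫[R] := by
    rw [inner_toEuclideanLin_transpose_mul_self]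
    exact add_nonneg (sq_nonneg _) (inner_toEuclideanLin_nonneg hR.posSemidef u)
  have hγd : γ * ‖d‖ ^ 2 ≤ (1 + γ * κ) * (⟪x, x⟫[Cᵀ * C] + ⟪u, u⟫[R]) := by
    have hγκ := mul_le_mul_of_nonneg_left (hd u (toEuclideanLin C x)) hγ
    rw [← inner_toEuclideanLin_transpose_mul_self, ← mul_assoc] at hγκ
    linarith
  have hscaled := mul_le_mul_of_nonneg_left ((hdist x d).trans (add_le_add_right hγd _)) hδ.le
  rw [mul_add, inv_mul_cancel_left₀ (by positivity), ← hnext] at hscaled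
  simp only [inner_toEuclideanLin_smul]
  linarith

lemma transpose_psdSqrt_mul_psdSqrt {n : ℕ} {Q : Matrix (Fin n) (Fin n) ℝ} (hQ : Q.PosSemidef) :
    (psdSqrt Q)ᵀ * psdSqrt Q = Q := by
  have hsymm : (psdSqrt Q)ᵀ = psdSqrt Q := (CFC.sqrt_nonneg Q).isSelfAdjoint.star_eq
  rw [hsymm]
  exact CFC.sqrt_mul_sqrt_self Q (nonneg_iff_posSemidef.2 hQ)

lemma IsDetectable.exists_isStrictStorage {n : ℕ} {A Q : Matrix (Fin n) (Fin n) ℝ}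
    {B : Matrix (Fin n) l ℝ} {R : Matrix l l ℝ}
    (hdet : IsDetectable A (psdSqrt Q)) (hQ : Q.PosSemidef) (hR : R.PosDef) :
    ∃ S c, IsStrictStorage A B Q R S c := by
  obtain ⟨G, hG⟩ := hdet
  obtain ⟨S, hS⟩ := exists_isLyapunov_of_tendsto_pow hG.tendsto_pow
  simpa only [transpose_psdSqrt_mul_psdSqrt hQ] using
    hS.exists_isStrictStorage (B := B) hR

end Detectability

section Riccati

variable {n l : Type*} [Fintype n] [Fintype l]

/-- The right-hand side of the discrete-time algebraic Riccati equation. -/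
noncomputable def riccatiMap [DecidableEq l] (A : Matrix n n ℝ) (B : Matrix n l ℝ)
    (Q : Matrix n n ℝ) (R : Matrix l l ℝ) (P : Matrix n n ℝ) : Matrix n n ℝ :=
  Aᵀ * P * A + Q - Aᵀ * P * B * (R + Bᵀ * P * B)⁻¹ * Bᵀ * P * A

/-- The feedback that attains the minimum in the Bellman operator `riccatiMap`. -/
noncomputable def riccatiGain [DecidableEq l] (A : Matrix n n ℝ) (B : Matrix n l ℝ)
    (R : Matrix l l ℝ) (P : Matrix n n ℝ) : Matrix l n ℝ :=
  -((R + Bᵀ * P * B)⁻¹ * Bᵀ * P * A)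

/-- The Bellman operator of the fixed linear feedback `u = K x`. -/
def policyMap (A : Matrix n n ℝ) (B : Matrix n l ℝ) (Q : Matrix n n ℝ) (R : Matrix l l ℝ)
    (K : Matrix l n ℝ) (P : Matrix n n ℝ) : Matrix n n ℝ :=
  Q + Kᵀ * R * K + (A + B * K)ᵀ * P * (A + B * K)

variable {A : Matrix n n ℝ} {B : Matrix n l ℝ} {Q : Matrix n n ℝ} {R : Matrix l l ℝ}
  {P : Matrix n n ℝ}

omit [Fintype l] in
lemma posDef_add_transpose_mul_mul [Finite l] (hR : R.PosDef) (hP : P.PosSemidef)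
    (B : Matrix n l ℝ) : (R + Bᵀ * P * B).PosDef :=
  hR.add_posSemidef (hP.conjTranspose_mul_mul_same B)

lemma posSemidef_policyMap (hQ : Q.PosSemidef) (hR : R.PosSemidef) (hP : P.PosSemidef)
    (K : Matrix l n ℝ) : (policyMap A B Q R K P).PosSemidef :=
  (hQ.add (hR.conjTranspose_mul_mul_same K)).add (hP.conjTranspose_mul_mul_same (A + B * K))

lemma policyMap_mono {P' : Matrix n n ℝ} (h : P ≤ P') (K : Matrix l n ℝ) :
    policyMap A B Q R K P ≤ policyMap A B Q R K P' :=
  add_le_add_right (transpose_mul_mul_mono h (A + B * K)) _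

lemma policyMap_eq_quadratic (K : Matrix l n ℝ) :
    policyMap A B Q R K P = Aᵀ * P * A + Q + Aᵀ * P * B * K + Kᵀ * (Bᵀ * P * A)
      + Kᵀ * (R + Bᵀ * P * B) * K := by
  simp only [policyMap, transpose_add, transpose_mul, Matrix.add_mul, Matrix.mul_add,
    Matrix.mul_assoc]
  abel

variable [DecidableEq l]

lemma riccatiMap_eq : riccatiMap A B Q R P = Q + Aᵀ * P * (A + B * riccatiGain A B R P) := by
  simp only [riccatiMap, riccatiGain, Matrix.mul_add, Matrix.mul_neg, Matrix.mul_assoc]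
  abel

lemma add_transpose_mul_mul_mul_riccatiGain (hR : R.PosDef) (hP : P.PosSemidef) :
    (R + Bᵀ * P * B) * riccatiGain A B R P = -(Bᵀ * P * A) := by
  have hunit : IsUnit (R + Bᵀ * P * B).det :=
    (isUnit_iff_isUnit_det _).1 (posDef_add_transpose_mul_mul hR hP B).isUnit
  rw [riccatiGain, Matrix.mul_neg, Matrix.mul_assoc _ Bᵀ, Matrix.mul_assoc _ (Bᵀ * P),
    mul_nonsing_inv_cancel_left _ _ hunit]

lemma mul_riccatiGain_add_eq_zero (hR : R.PosDef) (hP : P.PosSemidef) :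
    R * riccatiGain A B R P + Bᵀ * P * (A + B * riccatiGain A B R P) = 0 :=
  calc R * riccatiGain A B R P + Bᵀ * P * (A + B * riccatiGain A B R P)
      = (R + Bᵀ * P * B) * riccatiGain A B R P + Bᵀ * P * A := by
        simp only [Matrix.add_mul, Matrix.mul_add, Matrix.mul_assoc]
        abel
    _ = 0 := by rw [add_transpose_mul_mul_mul_riccatiGain hR hP, neg_add_cancel]

lemma policyMap_eq_riccatiMap_add (hR : R.PosDef) (hP : P.PosSemidef) (K : Matrix l n ℝ) :
    policyMap A B Q R K P = riccatiMap A B Q R P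
      + (K - riccatiGain A B R P)ᵀ * (R + Bᵀ * P * B) * (K - riccatiGain A B R P) := by
  have hgain := add_transpose_mul_mul_mul_riccatiGain (A := A) (B := B) hR hP
  have hgain' : (riccatiGain A B R P)ᵀ * (R + Bᵀ * P * B) = -(Aᵀ * P * B) := by
    have hPt : Pᵀ = P := hP.1
    have hHt : (R + Bᵀ * P * B)ᵀ = R + Bᵀ * P * B := (posDef_add_transpose_mul_mul hR hP B).1
    calc (riccatiGain A B R P)ᵀ * (R + Bᵀ * P * B)
        = ((R + Bᵀ * P * B) * riccatiGain A B R P)ᵀ := by rw [transpose_mul, hHt]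
      _ = -(Aᵀ * P * B) := by
        rw [hgain, transpose_neg, transpose_mul, transpose_mul, hPt, transpose_transpose,
          Matrix.mul_assoc]
  have hmap : riccatiMap A B Q R P = Aᵀ * P * A + Q + Aᵀ * P * B * riccatiGain A B R P := by
    rw [riccatiMap_eq, Matrix.mul_add, Matrix.mul_assoc (Aᵀ * P)]
    abel
  rw [policyMap_eq_quadratic, hmap, transpose_sub, Matrix.sub_mul, hgain', Matrix.sub_mul,
    Matrix.mul_sub, Matrix.mul_sub, Matrix.mul_assoc Kᵀ _ (riccatiGain A B R P), hgain]
  simp only [Matrix.mul_neg, Matrix.neg_mul]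
  abel

lemma riccatiMap_le_policyMap (hR : R.PosDef) (hP : P.PosSemidef) (K : Matrix l n ℝ) :
    riccatiMap A B Q R P ≤ policyMap A B Q R K P := by
  rw [policyMap_eq_riccatiMap_add hR hP K, Matrix.le_iff, add_sub_cancel_left]
  exact (posDef_add_transpose_mul_mul hR hP B).posSemidef.conjTranspose_mul_mul_same _

lemma policyMap_riccatiGain (hR : R.PosDef) (hP : P.PosSemidef) :
    policyMap A B Q R (riccatiGain A B R P) P = riccatiMap A B Q R P := by
  rw [policyMap_eq_riccatiMap_add hR hP, sub_self, Matrix.mul_zero, add_zero]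

lemma posSemidef_riccatiMap (hQ : Q.PosSemidef) (hR : R.PosDef) (hP : P.PosSemidef) :
    (riccatiMap A B Q R P).PosSemidef := by
  rw [← policyMap_riccatiGain hR hP]
  exact posSemidef_policyMap hQ hR.posSemidef hP _

lemma riccatiMap_mono (hR : R.PosDef) (hP : P.PosSemidef) {P' : Matrix n n ℝ}
    (hP' : P'.PosSemidef) (h : P ≤ P') : riccatiMap A B Q R P ≤ riccatiMap A B Q R P' :=
  calc riccatiMap A B Q R P ≤ policyMap A B Q R (riccatiGain A B R P') P :=
        riccatiMap_le_policyMap hR hP _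
    _ ≤ policyMap A B Q R (riccatiGain A B R P') P' := policyMap_mono h _
    _ = riccatiMap A B Q R P' := policyMap_riccatiGain hR hP'

omit [DecidableEq l] in
lemma IsLyapunov.exists_policyMap_le {K : Matrix l n ℝ} {S : Matrix n n ℝ}
    (hS : IsLyapunov (A + B * K) S) (hQ : Q.IsHermitian) (hR : R.IsHermitian) :
    ∃ S' : Matrix n n ℝ, S'.PosSemidef ∧ policyMap A B Q R K S' ≤ S' := by
  have hQR : (Q + Kᵀ * R * K).IsHermitian := hQ.add (isHermitian_conjTranspose_mul_mul K hR)
  obtain ⟨t, ht, hle⟩ := exists_one_le_le_smul hQR hS.posDef_decrease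
  refine ⟨t • S, hS.posDef.posSemidef.smul (by positivity), ?_⟩
  calc policyMap A B Q R K (t • S)
      ≤ t • (S - (A + B * K)ᵀ * S * (A + B * K)) + (A + B * K)ᵀ * (t • S) * (A + B * K) :=
        add_le_add_left hle _
    _ = t • S := by rw [Matrix.mul_smul, Matrix.smul_mul, smul_sub, sub_add_cancel]

lemma continuousAt_riccatiMap (hR : R.PosDef) (hP : P.PosSemidef) :
    ContinuousAt (riccatiMap A B Q R) P := by
  have hdet : (R + Bᵀ * P * B).det ≠ 0 := (posDef_add_transpose_mul_mul hR hP B).det_pos.ne'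
  have hinv : ContinuousAt (Inv.inv : Matrix l l ℝ → _) (R + Bᵀ * P * B) :=
    continuousAt_matrix_inv _ (by rw [Ring.inverse_eq_inv']; exact continuousAt_inv₀ hdet)
  have hweight : Continuous fun P : Matrix n n ℝ => R + Bᵀ * P * B := by fun_prop
  have hjoint : Continuous fun z : Matrix n n ℝ × Matrix l l ℝ =>
      Aᵀ * z.1 * A + Q - Aᵀ * z.1 * B * z.2 * Bᵀ * z.1 * A := by fun_prop
  have hpair : ContinuousAt (fun P => (P, (R + Bᵀ * P * B)⁻¹)) P :=
    continuousAt_id.prodMk (hinv.comp (f := fun P => R + Bᵀ * P * B) hweight.continuousAt)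
  exact (ContinuousAt.comp (f := fun P => (P, (R + Bᵀ * P * B)⁻¹)) hjoint.continuousAt
    hpair).congr (.of_forall fun _ => rfl)

omit [Fintype n] in
lemma exists_tendsto_of_monotone_of_le [Finite n] {p : ℕ → Matrix n n ℝ} {S : Matrix n n ℝ}
    (hp : ∀ k, (p k).PosSemidef) (hmono : Monotone p) (hS : ∀ k, p k ≤ S) :
    ∃ P : Matrix n n ℝ, P.PosSemidef ∧ Tendsto p atTop (𝓝 P) := by
  classical
  have := Fintype.ofFinite n
  have hform : ∀ x, ∃ a, Tendsto (fun k => ⟪x, x⟫[p k]) atTop (𝓝 a) := fun x =>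
    ⟨_, tendsto_atTop_ciSup (fun i j hij => inner_toEuclideanLin_mono (hmono hij) x)
      ⟨⟪x, x⟫[S], by rintro _ ⟨k, rfl⟩; exact inner_toEuclideanLin_mono (hS k) x⟩⟩
  choose q hq using hform
  have hentry : ∀ i j, ∃ a, Tendsto (fun k => p k i j) atTop (𝓝 a) := fun i j => by
    set x := EuclideanSpace.single i (1 : ℝ)
    set y := EuclideanSpace.single j (1 : ℝ)
    have hpolar : ∀ k, p k i j = (⟪x + y, x + y⟫[p k] - ⟪x - y, x - y⟫[p k]) / 4 := fun k => by
      have hij : ⟪x, y⟫[p k] = p k i j := by simp [x, y, EuclideanSpace.inner_single_left]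
      rw [sub_eq_add_neg x, inner_toEuclideanLin_add_add (hp k).1,
        inner_toEuclideanLin_add_add (hp k).1]
      simp only [map_neg, inner_neg_left, inner_neg_right, hij]
      ring
    simp_rw [hpolar]
    exact ⟨_, ((hq _).sub (hq _)).div_const 4⟩
  choose P hP using hentry
  have hlim : Tendsto p atTop (𝓝 (Matrix.of P)) :=
    tendsto_pi_nhds.2 fun i => tendsto_pi_nhds.2 fun j => hP i j
  have hherm : (Matrix.of P).IsHermitian :=
    tendsto_nhds_unique
      (((continuous_id.matrix_conjTranspose.tendsto _).comp hlim).congr fun k => (hp k).1) hlim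
  refine ⟨Matrix.of P, (posSemidef_iff_inner_nonneg hherm).2 fun x => ?_, hlim⟩
  have hcont : Continuous fun M : Matrix n n ℝ => ⟪x, x⟫[M] :=
    continuous_const.inner <| (PiLp.continuous_toLp 2 _).comp <|
      continuous_id.matrix_mulVec continuous_const
  exact ge_of_tendsto' ((hcont.tendsto _).comp hlim) fun k => inner_toEuclideanLin_nonneg (hp k) x

/- Value iteration from `0` increases and stays below every supersolution. -/
lemma exists_riccatiMap_eq_of_policyMap_le (hQ : Q.PosSemidef) (hR : R.PosDef)
    {K : Matrix l n ℝ} {S : Matrix n n ℝ} (hS : S.PosSemidef) (hKS : policyMap A B Q R K S ≤ S) :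
    ∃ P : Matrix n n ℝ, P.PosSemidef ∧ riccatiMap A B Q R P = P := by
  set p : ℕ → Matrix n n ℝ := fun k => (riccatiMap A B Q R)^[k] 0
  have hsucc : ∀ k, p (k + 1) = riccatiMap A B Q R (p k) := fun k =>
    Function.iterate_succ_apply' _ _ _
  have hp : ∀ k, (p k).PosSemidef := fun k => by
    induction k with
    | zero => exact Matrix.PosSemidef.zero
    | succ k ih => rw [hsucc]; exact posSemidef_riccatiMap hQ hR ih
  have hmono : Monotone p := monotone_nat_of_le_succ fun k => by
    induction k with
    | zero => exact nonneg_iff_posSemidef.2 (hp 1)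
    | succ k ih =>
      exact (hsucc k).le.trans
        ((riccatiMap_mono hR (hp k) (hp (k + 1)) ih).trans (hsucc (k + 1)).ge)
  have hle : ∀ k, p k ≤ S := fun k => by
    induction k with
    | zero => exact nonneg_iff_posSemidef.2 hS
    | succ k ih =>
      rw [hsucc]
      exact (riccatiMap_le_policyMap hR (hp k) K).trans ((policyMap_mono ih K).trans hKS)
  obtain ⟨P, hP, hlim⟩ := exists_tendsto_of_monotone_of_le hp hmono hle
  refine ⟨P, hP, tendsto_nhds_unique ?_ ((tendsto_add_atTop_iff_nat 1).2 hlim)⟩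
  simpa only [Function.comp_def, hsucc] using
    (continuousAt_riccatiMap (A := A) (B := B) (Q := Q) hR hP).tendsto.comp hlim

lemma IsStabilizable.exists_riccatiMap_eq {n l : ℕ} {A Q : Matrix (Fin n) (Fin n) ℝ}
    {B : Matrix (Fin n) (Fin l) ℝ} {R : Matrix (Fin l) (Fin l) ℝ} (hstab : IsStabilizable A B)
    (hQ : Q.PosSemidef) (hR : R.PosDef) :
    ∃ P : Matrix (Fin n) (Fin n) ℝ, P.PosSemidef ∧ riccatiMap A B Q R P = P := by
  obtain ⟨F, hF⟩ := hstab
  obtain ⟨S, hS⟩ := exists_isLyapunov_of_tendsto_pow hF.tendsto_pow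
  obtain ⟨S', hS', hle⟩ := hS.exists_policyMap_le hQ.1 hR.1
  exact exists_riccatiMap_eq_of_policyMap_le hQ hR hS' hle

lemma IsStrictStorage.smul_one_le [DecidableEq n] {S : Matrix n n ℝ} {c : ℝ}
    (hS : IsStrictStorage A B Q R S c) (hQ : Q.IsHermitian) (hR : R.IsHermitian)
    (K : Matrix l n ℝ) :
    c • (1 : Matrix n n ℝ) ≤ Q + Kᵀ * R * K + (S - (A + B * K)ᵀ * S * (A + B * K)) := by
  have hKRK : (Kᵀ * R * K).IsHermitian := isHermitian_conjTranspose_mul_mul K hR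
  have hnext : ((A + B * K)ᵀ * S * (A + B * K)).IsHermitian :=
    isHermitian_conjTranspose_mul_mul (A + B * K) hS.posDef.1
  refine (le_iff_inner_le (isHermitian_one.smul (.all _))
    ((hQ.add hKRK).add (hS.posDef.1.sub hnext))).2 fun x => ?_
  simp only [inner_toEuclideanLin_smul_one, map_sub, LinearMap.sub_apply, map_add,
    LinearMap.add_apply, inner_sub_right, inner_add_right]
  have hsupply := hS.le_supply x (toEuclideanLin K x)
  rw [inner_toEuclideanLin_transpose_mul_mul, inner_toEuclideanLin_transpose_mul_mul, map_add,
    LinearMap.add_apply, toEuclideanLin_mul_apply]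
  linarith

lemma IsStrictStorage.isLyapunov_closedLoop [DecidableEq n] {S : Matrix n n ℝ} {c : ℝ}
    (hS : IsStrictStorage A B Q R S c) (hQ : Q.IsHermitian) (hR : R.PosDef) (hP : P.PosSemidef)
    (hric : riccatiMap A B Q R P = P) : IsLyapunov (A + B * riccatiGain A B R P) (P + S) := by
  refine ⟨hS.posDef.posSemidef_add hP, posDef_of_smul_one_le hS.rate_pos ?_⟩
  have hpolicy := (policyMap_riccatiGain (A := A) (B := B) (Q := Q) hR hP).trans hric
  convert hS.smul_one_le hQ hR.1 (riccatiGain A B R P) using 1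
  rw [Matrix.mul_add _ P S, Matrix.add_mul, add_sub_add_comm]
  exact congrArg (· + _) (sub_eq_of_eq_add hpolicy.symm)

end Riccati

section OptimalSteadyState

lemma exists_lagrangeMultiplier {k V Y : Type*} [Field k] [AddCommGroup V] [Module k V]
    [FiniteDimensional k V] [AddCommGroup Y] [Module k Y] (b : LinearMap.BilinForm k V)
    (φ : Module.Dual k V) (T : V →ₗ[k] Y) (hb : ∀ h ∈ LinearMap.ker T, b h h = 0 → h = 0)
    (e₀ : V) : ∃ e, T e = T e₀ ∧ ∃ ψ : Module.Dual k Y, ∀ h, b e h = φ h + ψ (T h) := by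
  have hinj : Function.Injective (b.domRestrict₁₂ (LinearMap.ker T) (LinearMap.ker T)) := by
    refine (injective_iff_map_eq_zero _).2 fun h hh => Subtype.ext (hb h h.2 ?_)
    exact LinearMap.congr_fun hh h
  have hsurj := (LinearMap.injective_iff_surjective_of_finrank_eq_finrank
    (Subspace.dual_finrank_eq (K := k)).symm).1 hinj
  obtain ⟨h₁, hh₁⟩ := hsurj ((φ - b e₀).domRestrict (LinearMap.ker T))
  have hvanish : ∀ h ∈ LinearMap.ker T, (b (e₀ + h₁) - φ) h = 0 := fun h hh => by
    have hker : b h₁ h = φ h - b e₀ h := LinearMap.congr_fun hh₁ ⟨h, hh⟩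
    rw [map_add, LinearMap.sub_apply, LinearMap.add_apply, hker]
    ring
  have hrange : b (e₀ + h₁) - φ ∈ LinearMap.range T.dualMap := by
    rw [LinearMap.range_dualMap_eq_dualAnnihilator_ker, Submodule.mem_dualAnnihilator]
    exact hvanish
  obtain ⟨ψ, hψ⟩ := hrange
  refine ⟨e₀ + h₁, by rw [map_add, LinearMap.mem_ker.1 h₁.2, add_zero], ψ, fun h => ?_⟩
  rw [← sub_eq_iff_eq_add', ← LinearMap.sub_apply, ← hψ, LinearMap.dualMap_apply]

lemma IsStrictStorage.eq_zero_of_steady {n l : Type*} [Fintype n] [DecidableEq n] [Fintype l]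
    [DecidableEq l] {A Q S : Matrix n n ℝ} {B : Matrix n l ℝ} {R : Matrix l l ℝ} {c : ℝ}
    (hS : IsStrictStorage A B Q R S c) (hR : R.PosDef) {x : EuclideanSpace ℝ n}
    {u : EuclideanSpace ℝ l} (hsteady : x = toEuclideanLin A x + toEuclideanLin B u)
    (hsupply : ⟪x, x⟫[Q] + ⟪u, u⟫[R] = 0) : x = 0 ∧ u = 0 := by
  have hx : x = 0 := by
    have hle := hS.le_supply x u
    rw [← hsteady, add_sub_cancel_right, hsupply] at hle
    exact norm_eq_zero.1 (pow_eq_zero_iff two_ne_zero |>.1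
      (le_antisymm (nonpos_of_mul_nonpos_right hle hS.rate_pos) (sq_nonneg _)))
  obtain ⟨r, hr, hrR⟩ := exists_pos_mul_norm_sq_le hR
  have hle := hrR u
  rw [hx, map_zero, inner_zero_left, zero_add] at hsupply
  rw [hsupply] at hle
  exact ⟨hx, norm_eq_zero.1 (pow_eq_zero_iff two_ne_zero |>.1
    (le_antisymm (nonpos_of_mul_nonpos_right hle hr) (sq_nonneg _)))⟩

namespace LQProblem

variable {n l m : ℕ} (p : LQProblem n l m)

lemma f_sub_f (x x' : EuclideanSpace ℝ (Fin n)) (u u' : EuclideanSpace ℝ (Fin l))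
    (w w' : EuclideanSpace ℝ (Fin m)) :
    p.f x u w - p.f x' u' w' = toEuclideanLin p.A (x - x') + toEuclideanLin p.B (u - u') +
      toEuclideanLin p.E (w - w') := by
  simp only [f, map_sub]
  abel

/-- `ν` is a Lagrange multiplier of the optimal steady state problem at `(xe, ue)`: the derivative
of the deterministic stage cost is the functional `(d, v) ↦ ⟪ν, A d + B v - d⟫`. -/
def IsLagrangeMultiplier (xe : EuclideanSpace ℝ (Fin n)) (ue : EuclideanSpace ℝ (Fin l))
    (ν : EuclideanSpace ℝ (Fin n)) : Prop :=
  ∀ d v, 2 * ⟪d, xe⟫[p.Q₁] + ⟪p.s, d⟫ + (2 * ⟪v, ue⟫[p.R₁] + ⟪p.v, v⟫) =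
    ⟪ν, toEuclideanLin p.A d + toEuclideanLin p.B v - d⟫

/-- The polar form of the quadratic part of the deterministic stage cost. -/
noncomputable def costForm :
    LinearMap.BilinForm ℝ (EuclideanSpace ℝ (Fin n) × EuclideanSpace ℝ (Fin l)) :=
  (innerₗ _).compl₁₂ (.fst ℝ _ _) (toEuclideanLin p.Q₁ ∘ₗ .fst ℝ _ _) +
    (innerₗ _).compl₁₂ (.snd ℝ _ _) (toEuclideanLin p.R₁ ∘ₗ .snd ℝ _ _)

/-- The linear map `(x, u) ↦ A x + B u - x`, of which the set of steady states is a level set. -/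
noncomputable def steadyMap :
    EuclideanSpace ℝ (Fin n) × EuclideanSpace ℝ (Fin l) →ₗ[ℝ] EuclideanSpace ℝ (Fin n) :=
  (toEuclideanLin p.A - .id).coprod (toEuclideanLin p.B)

lemma steadyMap_apply (h : EuclideanSpace ℝ (Fin n) × EuclideanSpace ℝ (Fin l)) :
    p.steadyMap h = toEuclideanLin p.A h.1 + toEuclideanLin p.B h.2 - h.1 := by
  rw [steadyMap, LinearMap.coprod_apply, LinearMap.sub_apply, LinearMap.id_apply,
    sub_add_eq_add_sub]

lemma isSteadyState_iff (w : EuclideanSpace ℝ (Fin m)) (x : EuclideanSpace ℝ (Fin n))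
    (u : EuclideanSpace ℝ (Fin l)) :
    p.IsSteadyState w x u ↔ p.steadyMap (x, u) = -(toEuclideanLin p.E w + p.z) := by
  rw [IsSteadyState, f, steadyMap_apply, eq_neg_iff_add_eq_zero, eq_comm, ← sub_eq_zero]
  exact Eq.congr (by abel) rfl

variable {p}

lemma detStageCost_sub (hQ₁ : p.Q₁.IsHermitian) (hR₁ : p.R₁.IsHermitian)
    (x x' : EuclideanSpace ℝ (Fin n)) (u u' : EuclideanSpace ℝ (Fin l)) :
    p.detStageCost x u - p.detStageCost x' u' =
      ⟪x - x', x - x'⟫[p.Q₁] + ⟪u - u', u - u'⟫[p.R₁] +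
        (2 * ⟪x - x', x'⟫[p.Q₁] + ⟪p.s, x - x'⟫ +
          (2 * ⟪u - u', u'⟫[p.R₁] + ⟪p.v, u - u'⟫)) := by
  simp only [detStageCost, map_sub, inner_sub_left, inner_sub_right,
    inner_toEuclideanLin_comm hQ₁ x' x, inner_toEuclideanLin_comm hR₁ u' u]
  ring

lemma IsLagrangeMultiplier.isOptimalSteadyState {w : EuclideanSpace ℝ (Fin m)}
    {xe ν : EuclideanSpace ℝ (Fin n)} {ue : EuclideanSpace ℝ (Fin l)}
    (hν : p.IsLagrangeMultiplier xe ue ν) (hQ₁ : p.Q₁.PosSemidef) (hR₁ : p.R₁.PosSemidef)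
    (hsteady : p.IsSteadyState w xe ue) : p.IsOptimalSteadyState w xe ue := by
  refine ⟨hsteady, fun x u hxu => sub_nonneg.1 ?_⟩
  have hfeasible : toEuclideanLin p.A (x - xe) + toEuclideanLin p.B (u - ue) = x - xe := by
    have hsub := p.f_sub_f x xe u ue w w
    rwa [← hxu, ← hsteady, sub_self, map_zero, add_zero, eq_comm] at hsub
  rw [detStageCost_sub hQ₁.1 hR₁.1, hν, hfeasible, sub_self, inner_zero_right, add_zero]
  exact add_nonneg (inner_toEuclideanLin_nonneg hQ₁ _) (inner_toEuclideanLin_nonneg hR₁ _)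

lemma exists_isLagrangeMultiplier (hQ₁ : p.Q₁.IsHermitian) (hR₁ : p.R₁.PosDef)
    {S : Matrix (Fin n) (Fin n) ℝ} {c : ℝ} (hS : IsStrictStorage p.A p.B p.Q₁ p.R₁ S c)
    {w : EuclideanSpace ℝ (Fin m)} (hsteady : ∃ x u, p.IsSteadyState w x u) :
    ∃ xe ue ν, p.IsSteadyState w xe ue ∧ p.IsLagrangeMultiplier xe ue ν := by
  obtain ⟨x, u, hxu⟩ := hsteady
  have hanisotropic : ∀ h ∈ LinearMap.ker p.steadyMap, p.costForm h h = 0 → h = 0 :=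
    fun h hker hform => Prod.ext_iff.2 <| hS.eq_zero_of_steady hR₁
      (sub_eq_zero.1 ((p.steadyMap_apply h).symm.trans hker)).symm hform
  obtain ⟨⟨xe, ue⟩, he, ψ, hψ⟩ := exists_lagrangeMultiplier p.costForm
    (-(2⁻¹ : ℝ) • (innerₗ _ p.s).coprod (innerₗ _ p.v)) p.steadyMap hanisotropic (x, u)
  refine ⟨xe, ue, (InnerProductSpace.toDual ℝ _).symm ((2 : ℝ) • ψ).toContinuousLinearMap,
    (p.isSteadyState_iff w xe ue).2 (he.trans ((p.isSteadyState_iff w x u).1 hxu)), fun d v => ?_⟩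
  have hstationary : ⟪xe, d⟫[p.Q₁] + ⟪ue, v⟫[p.R₁] =
      -2⁻¹ * (⟪p.s, d⟫ + ⟪p.v, v⟫) + ψ (p.steadyMap (d, v)) := hψ (d, v)
  rw [InnerProductSpace.toDual_symm_apply, LinearMap.coe_toContinuousLinearMap',
    LinearMap.smul_apply, smul_eq_mul, ← p.steadyMap_apply (d, v),
    inner_toEuclideanLin_comm hQ₁ d, inner_toEuclideanLin_comm hR₁.1 v]
  linarith

end LQProblem

end OptimalSteadyState

@[fun_prop]
lemma measurable_toEuclideanLin {n m : Type*} [Finite n] [Fintype m] [DecidableEq m]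
    (M : Matrix n m ℝ) : Measurable (toEuclideanLin M) :=
  have := Fintype.ofFinite n
  (LinearMap.continuous_of_finiteDimensional _).measurable

section SquareIntegrable

variable {Ω : Type*} [MeasurableSpace Ω] {μ : Measure Ω}

lemma integrable_inner_of_memLp {F : Type*} [NormedAddCommGroup F] [InnerProductSpace ℝ F]
    {X Y : Ω → F} (hX : MemLp X 2 μ) (hY : MemLp Y 2 μ) :
    Integrable (fun ω => ⟪X ω, Y ω⟫) μ :=
  memLp_one_iff_integrable.1 ((innerSL ℝ).memLp_of_bilin 1 hX hY)

variable {n m : Type*} [Fintype n] [Fintype m] [DecidableEq m]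

lemma memLp_toEuclideanLin (M : Matrix n m ℝ) {X : Ω → EuclideanSpace ℝ m} {q : ENNReal}
    (hX : MemLp X q μ) : MemLp (fun ω => toEuclideanLin M (X ω)) q μ :=
  (toEuclideanLin M).toContinuousLinearMap.comp_memLp' hX

lemma integral_toEuclideanLin (M : Matrix n m ℝ) {X : Ω → EuclideanSpace ℝ m}
    (hX : Integrable X μ) : ∫ ω, toEuclideanLin M (X ω) ∂μ = toEuclideanLin M (∫ ω, X ω ∂μ) :=
  (toEuclideanLin M).toContinuousLinearMap.integral_comp_comm hX

lemma integrable_inner_toEuclideanLin (M : Matrix n m ℝ) {X : Ω → EuclideanSpace ℝ n}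
    {Y : Ω → EuclideanSpace ℝ m} (hX : MemLp X 2 μ) (hY : MemLp Y 2 μ) :
    Integrable (fun ω => ⟪X ω, Y ω⟫[M]) μ :=
  integrable_inner_of_memLp hX (memLp_toEuclideanLin M hY)

lemma integral_toEuclideanLin_centered [IsProbabilityMeasure μ] (M : Matrix n m ℝ)
    {X : Ω → EuclideanSpace ℝ m} (hX : Integrable X μ) :
    ∫ ω, toEuclideanLin M (X ω - ∫ ω', X ω' ∂μ) ∂μ = 0 := by
  have hXc : Integrable (fun ω => X ω - ∫ ω', X ω' ∂μ) μ := hX.sub (integrable_const _)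
  rw [integral_toEuclideanLin M hXc, integral_sub hX (integrable_const _), integral_const,
    probReal_univ, one_smul, sub_self, map_zero]

lemma integral_inner_centered_eq_zero [IsProbabilityMeasure μ] (M : Matrix n m ℝ)
    {Z : Ω → EuclideanSpace ℝ n} {W : Ω → EuclideanSpace ℝ m} (hZ : Integrable Z μ)
    (hW : Integrable W μ) (h : IndepFun Z W μ) :
    ∫ ω, ⟪Z ω, W ω - ∫ ω', W ω' ∂μ⟫[M] ∂μ = 0 := by
  have hindep : IndepFun Z (fun ω => toEuclideanLin M (W ω - ∫ ω', W ω' ∂μ)) μ :=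
    h.comp (ψ := fun w => toEuclideanLin M (w - ∫ ω', W ω' ∂μ)) measurable_id (by fun_prop)
  have hint := (toEuclideanLin M).toContinuousLinearMap.integrable_comp
    (hW.sub (integrable_const (∫ ω', W ω' ∂μ)))
  have hprod : ∫ ω, ⟪Z ω, W ω - ∫ ω', W ω' ∂μ⟫[M] ∂μ =
      ⟪∫ ω, Z ω ∂μ, ∫ ω, toEuclideanLin M (W ω - ∫ ω', W ω' ∂μ) ∂μ⟫ :=
    hindep.integral_bilin hZ hint (innerSL ℝ)
  rw [hprod, integral_toEuclideanLin_centered M hW, inner_zero_right]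

lemma integral_inner_sub_centered_eq_zero [IsProbabilityMeasure μ] (M : Matrix n m ℝ)
    {Z Z' : Ω → EuclideanSpace ℝ n} {W : Ω → EuclideanSpace ℝ m} (hZ : MemLp Z 2 μ)
    (hZ' : MemLp Z' 2 μ) (hW : MemLp W 2 μ) (h : IndepFun Z W μ) (h' : IndepFun Z' W μ) :
    ∫ ω, ⟪Z ω - Z' ω, W ω - ∫ ω', W ω' ∂μ⟫[M] ∂μ = 0 := by
  have hWc : MemLp (fun ω => W ω - ∫ ω', W ω' ∂μ) 2 μ := hW.sub (memLp_const _)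
  have hWi := hW.integrable one_le_two
  simp_rw [inner_sub_left]
  rw [integral_sub (integrable_inner_toEuclideanLin M hZ hWc)
    (integrable_inner_toEuclideanLin M hZ' hWc),
    integral_inner_centered_eq_zero M (hZ.integrable one_le_two) hWi h,
    integral_inner_centered_eq_zero M (hZ'.integrable one_le_two) hWi h', sub_zero]

lemma two_mul_inner_sub_le {Q : Matrix m m ℝ} (hQ : Q.PosSemidef) (a b : EuclideanSpace ℝ m) :
    2 * ⟪a - b, b⟫[Q] ≤ ⟪a, a⟫[Q] - ⟪b, b⟫[Q] := by
  have hnonneg := inner_toEuclideanLin_nonneg hQ (a - b)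
  simp only [map_sub, inner_sub_left, inner_sub_right, inner_toEuclideanLin_comm hQ.1 b a]
    at hnonneg ⊢
  linarith

variable [IsProbabilityMeasure μ] {d : ℕ}

lemma trace_mul_covMatrix (Q : Matrix (Fin d) (Fin d) ℝ) {X : Ω → EuclideanSpace ℝ (Fin d)}
    (hX : MemLp X 2 μ) : (Q * covMatrix μ X).trace =
      ∫ ω, ⟪X ω - ∫ ω', X ω' ∂μ, X ω - ∫ ω', X ω' ∂μ⟫[Q] ∂μ := by
  have hXi : ∀ i, MemLp (fun ω => X ω i) 2 μ := fun i => hX.eval_piLp i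
  have hmean : ∀ i, (∫ ω', X ω' ∂μ) i = ∫ ω', X ω' i ∂μ := fun i =>
    eval_integral_piLp (fun i => (hXi i).integrable one_le_two) i
  have hint : ∀ i j, Integrable
      (fun ω => Q i j * ((X ω j - ∫ ω', X ω' j ∂μ) * (X ω i - ∫ ω', X ω' i ∂μ))) μ := fun i j =>
    (((hXi j).sub (memLp_const _)).integrable_mul ((hXi i).sub (memLp_const _))).const_mul _
  have hcoord : ∀ ω, ⟪X ω - ∫ ω', X ω' ∂μ, X ω - ∫ ω', X ω' ∂μ⟫[Q] =
      ∑ i, ∑ j, Q i j * ((X ω j - ∫ ω', X ω' j ∂μ) * (X ω i - ∫ ω', X ω' i ∂μ)) := fun ω => by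
    simp only [EuclideanSpace.inner_eq_star_dotProduct, star_trivial, dotProduct,
      ofLp_toLpLin, toLin'_apply, mulVec, WithLp.ofLp_sub, Pi.sub_apply, hmean, Finset.sum_mul,
      mul_assoc]
  simp_rw [hcoord]
  rw [integral_finsetSum _ fun i _ => integrable_finsetSum _ fun j _ => hint i j]
  refine Finset.sum_congr rfl fun i _ => ?_
  rw [integral_finsetSum _ fun j _ => hint i j]
  simp_rw [integral_const_mul]
  rfl

lemma integral_inner_sub_le_trace_mul_covMatrix_sub {Q : Matrix (Fin d) (Fin d) ℝ}
    (hQ : Q.PosSemidef) {X Y : Ω → EuclideanSpace ℝ (Fin d)} (hX : MemLp X 2 μ)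
    (hY : MemLp Y 2 μ) :
    ∫ ω, 2 * ⟪X ω - Y ω, Y ω - ∫ ω', Y ω' ∂μ⟫[Q] ∂μ ≤
      (Q * covMatrix μ X).trace - (Q * covMatrix μ Y).trace := by
  set x := ∫ ω', X ω' ∂μ
  set y := ∫ ω', Y ω' ∂μ
  have hXc : MemLp (fun ω => X ω - x) 2 μ := hX.sub (memLp_const _)
  have hYc : MemLp (fun ω => Y ω - y) 2 μ := hY.sub (memLp_const _)
  have hD : MemLp (fun ω => X ω - Y ω) 2 μ := hX.sub hY
  have hmean : ∫ ω, ⟪x - y, Y ω - y⟫[Q] ∂μ = 0 := by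
    rw [integral_inner ((memLp_toEuclideanLin Q hYc).integrable one_le_two),
      integral_toEuclideanLin_centered Q (hY.integrable one_le_two), inner_zero_right]
  have hQX := integrable_inner_toEuclideanLin Q hXc hXc
  have hQY := integrable_inner_toEuclideanLin Q hYc hYc
  have hXY := (integrable_inner_toEuclideanLin Q hD hYc).const_mul 2
  have hxy := (integrable_inner_toEuclideanLin Q (memLp_const (x - y)) hYc).const_mul 2
  calc ∫ ω, 2 * ⟪X ω - Y ω, Y ω - y⟫[Q] ∂μ
      = ∫ ω, (2 * ⟪X ω - Y ω, Y ω - y⟫[Q] - 2 * ⟪x - y, Y ω - y⟫[Q]) ∂μ := by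
        rw [integral_sub hXY hxy, integral_const_mul 2 fun ω => ⟪x - y, Y ω - y⟫[Q], hmean,
          mul_zero, sub_zero]
    _ ≤ ∫ ω, (⟪X ω - x, X ω - x⟫[Q] - ⟪Y ω - y, Y ω - y⟫[Q]) ∂μ := by
        refine integral_mono (hXY.sub hxy) (hQX.sub hQY) fun ω => ?_
        refine le_of_eq_of_le ?_ (two_mul_inner_sub_le hQ (X ω - x) (Y ω - y))
        rw [sub_sub_sub_comm (X ω), inner_sub_left (X ω - Y ω), mul_sub]
    _ = (Q * covMatrix μ X).trace - (Q * covMatrix μ Y).trace := by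
        rw [integral_sub hQX hQY, trace_mul_covMatrix Q hX, trace_mul_covMatrix Q hY]

end SquareIntegrable

section Dissipativity

lemma inner_riccati {n l : Type*} [Fintype n] [DecidableEq n] [Fintype l] [DecidableEq l]
    {A Q P : Matrix n n ℝ} {B : Matrix n l ℝ} {R : Matrix l l ℝ} (hR : R.PosDef)
    (hP : P.PosSemidef) (hric : riccatiMap A B Q R P = P) (d y : EuclideanSpace ℝ n)
    (v : EuclideanSpace ℝ l) :
    ⟪d, y⟫[P] = ⟪d, y⟫[Q] + ⟪v, toEuclideanLin (riccatiGain A B R P) y⟫[R] +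
      ⟪toEuclideanLin A d + toEuclideanLin B v,
        toEuclideanLin (A + B * riccatiGain A B R P) y⟫[P] := by
  set K := riccatiGain A B R P
  have hstate : ⟪d, y⟫[P] = ⟪d, y⟫[Q] + ⟪toEuclideanLin A d, toEuclideanLin (A + B * K) y⟫[P] := by
    rw [← inner_toEuclideanLin_transpose, ← toEuclideanLin_mul_apply, ← toEuclideanLin_mul_apply,
      ← inner_add_right, ← LinearMap.add_apply, ← map_add, ← riccatiMap_eq, hric]
  have hcontrol : ⟪v, toEuclideanLin K y⟫[R] +
      ⟪toEuclideanLin B v, toEuclideanLin (A + B * K) y⟫[P] = 0 := by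
    rw [← inner_toEuclideanLin_transpose, ← toEuclideanLin_mul_apply, ← toEuclideanLin_mul_apply,
      ← toEuclideanLin_mul_apply, ← inner_add_right, ← LinearMap.add_apply, ← map_add,
      mul_riccatiGain_add_eq_zero hR hP, map_zero, LinearMap.zero_apply, inner_zero_right]
  rw [inner_add_left]
  linarith

namespace LQProblem

variable {n l m : ℕ} {p : LQProblem n l m}

/-- One step of the system under the affine feedback `u = K (x - xe) + ue`. -/
noncomputable def feedbackStep (p : LQProblem n l m) (K : Matrix (Fin l) (Fin n) ℝ)
    (xe : EuclideanSpace ℝ (Fin n)) (ue : EuclideanSpace ℝ (Fin l)) (x : EuclideanSpace ℝ (Fin n))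
    (w : EuclideanSpace ℝ (Fin m)) : EuclideanSpace ℝ (Fin n) :=
  p.f x (toEuclideanLin K (x - xe) + ue) w

lemma measurable_feedbackStep (p : LQProblem n l m) (K : Matrix (Fin l) (Fin n) ℝ)
    (xe : EuclideanSpace ℝ (Fin n)) (ue : EuclideanSpace ℝ (Fin l)) :
    Measurable (Function.uncurry (p.feedbackStep K xe ue)) := by
  unfold feedbackStep f Function.uncurry
  fun_prop

section Feedback

variable {K : Matrix (Fin l) (Fin n) ℝ} {xe : EuclideanSpace ℝ (Fin n)}
  {ue : EuclideanSpace ℝ (Fin l)}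

lemma IsSteadyState.feedbackStep_sub {w : EuclideanSpace ℝ (Fin m)} (h : p.IsSteadyState w xe ue)
    (x : EuclideanSpace ℝ (Fin n)) (w' : EuclideanSpace ℝ (Fin m)) :
    p.feedbackStep K xe ue x w' - xe =
      toEuclideanLin (p.A + p.B * K) (x - xe) + toEuclideanLin p.E (w' - w) := by
  nth_rewrite 2 [show xe = p.f xe ue w from h]
  rw [feedbackStep, f_sub_f, add_sub_cancel_right, map_add, LinearMap.add_apply,
    toEuclideanLin_mul_apply]

variable {Ω : Type*} [MeasurableSpace Ω] {μ : Measure Ω} {W : ℕ → Ω → EuclideanSpace ℝ (Fin m)}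
  {ϱ : Measure (EuclideanSpace ℝ (Fin n))} {Xs : ℕ → Ω → EuclideanSpace ℝ (Fin n)}
  {Us : ℕ → Ω → EuclideanSpace ℝ (Fin l)}

namespace IsFeedbackSolution

lemma indepFun_control (h : p.IsFeedbackSolution μ W K xe ue ϱ Xs Us) (k : ℕ) :
    IndepFun (Us k) (W k) μ := by
  have hmeas : Measurable fun x => toEuclideanLin K (x - xe) + ue := by fun_prop
  exact ((h.indep k).comp hmeas measurable_id).congr (h.feedback k).symm ae_eq_rfl

lemma memLp_control [IsFiniteMeasure μ] (h : p.IsFeedbackSolution μ W K xe ue ϱ Xs Us) {k : ℕ}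
    (hX : MemLp (Xs k) 2 μ) : MemLp (Us k) 2 μ :=
  (memLp_congr_ae (h.feedback k)).2
    ((memLp_toEuclideanLin K (hX.sub (memLp_const xe))).add (memLp_const ue))

lemma integral_control [IsProbabilityMeasure μ] (h : p.IsFeedbackSolution μ W K xe ue ϱ Xs Us)
    {k : ℕ} (hX : Integrable (Xs k) μ) (hmean : ∫ ω, Xs k ω ∂μ = xe) : ∫ ω, Us k ω ∂μ = ue := by
  have hlin := (toEuclideanLin K).toContinuousLinearMap.integrable_comp
    (hX.sub (integrable_const xe))
  rw [integral_congr_ae (h.feedback k), ← hmean]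
  rw [← hmean] at hlin
  refine (integral_add hlin (integrable_const ue)).trans ?_
  rw [integral_const, probReal_univ, one_smul]
  exact add_eq_right.2 (integral_toEuclideanLin_centered K hX)

end IsFeedbackSolution

end Feedback

section Moments

variable {Ω : Type*} [MeasurableSpace Ω] {μ : Measure Ω} [IsProbabilityMeasure μ]

lemma memLp_f (p : LQProblem n l m) {X : Ω → EuclideanSpace ℝ (Fin n)}
    {U : Ω → EuclideanSpace ℝ (Fin l)} {W : Ω → EuclideanSpace ℝ (Fin m)} (hX : MemLp X 2 μ)
    (hU : MemLp U 2 μ) (hW : MemLp W 2 μ) : MemLp (fun ω => p.f (X ω) (U ω) (W ω)) 2 μ :=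
  (((memLp_toEuclideanLin p.A hX).add (memLp_toEuclideanLin p.B hU)).add
    (memLp_toEuclideanLin p.E hW)).add (memLp_const _)

lemma integrable_detStageCost (p : LQProblem n l m) {X : Ω → EuclideanSpace ℝ (Fin n)}
    {U : Ω → EuclideanSpace ℝ (Fin l)} (hX : MemLp X 2 μ) (hU : MemLp U 2 μ) :
    Integrable (fun ω => p.detStageCost (X ω) (U ω)) μ :=
  ((((integrable_inner_toEuclideanLin p.Q₁ hX hX).add
    (integrable_inner_toEuclideanLin p.R₁ hU hU)).add
    (integrable_inner_of_memLp (memLp_const p.s) hX)).add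
    (integrable_inner_of_memLp (memLp_const p.v) hU)).add (integrable_const _)

lemma integral_cross_eq_zero (P : Matrix (Fin n) (Fin n) ℝ) {X Xs : Ω → EuclideanSpace ℝ (Fin n)}
    {U Us : Ω → EuclideanSpace ℝ (Fin l)} {W : Ω → EuclideanSpace ℝ (Fin m)} (hX : MemLp X 2 μ)
    (hXs : MemLp Xs 2 μ) (hU : MemLp U 2 μ) (hUs : MemLp Us 2 μ) (hW : MemLp W 2 μ)
    (hXW : IndepFun X W μ) (hXsW : IndepFun Xs W μ) (hUW : IndepFun U W μ)
    (hUsW : IndepFun Us W μ) :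
    ∫ ω, ⟪toEuclideanLin p.A (X ω - Xs ω) + toEuclideanLin p.B (U ω - Us ω),
      toEuclideanLin p.E (W ω - ∫ ω', W ω' ∂μ)⟫[P] ∂μ = 0 := by
  have hD : MemLp (fun ω => X ω - Xs ω) 2 μ := hX.sub hXs
  have hV : MemLp (fun ω => U ω - Us ω) 2 μ := hU.sub hUs
  have hWc : MemLp (fun ω => W ω - ∫ ω', W ω' ∂μ) 2 μ := hW.sub (memLp_const _)
  simp_rw [inner_add_left, ← inner_toEuclideanLin_transpose_mul_mul]
  rw [integral_add (integrable_inner_toEuclideanLin _ hD hWc)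
    (integrable_inner_toEuclideanLin _ hV hWc),
    integral_inner_sub_centered_eq_zero _ hX hXs hW hXW hXsW,
    integral_inner_sub_centered_eq_zero _ hU hUs hW hUW hUsW, add_zero]

end Moments

/-- The standing assumptions on the weights of the stage cost. -/
structure IsConvex (p : LQProblem n l m) : Prop where
  posSemidef_Q₁ : p.Q₁.PosSemidef
  posSemidef_Q₂ : p.Q₂.PosSemidef
  posDef_R₁ : p.R₁.PosDef
  posSemidef_R₂ : p.R₂.PosSemidef

lemma IsConvex.posDef_add (h : p.IsConvex) : (p.R₁ + p.R₂).PosDef :=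
  h.posDef_R₁.add_posSemidef h.posSemidef_R₂

/-- The matrices and vectors from which the storage function of the stochastic problem with mean
noise `w` is built: a solution `P` of the Riccati equation, a steady state `(xe, ue)` with Lagrange
multiplier `ν`, and a strict storage matrix `S` with rate `c` for the deterministic cost. -/
structure Certificate (p : LQProblem n l m) (w : EuclideanSpace ℝ (Fin m)) where
  P : Matrix (Fin n) (Fin n) ℝ
  S : Matrix (Fin n) (Fin n) ℝ
  xe : EuclideanSpace ℝ (Fin n)
  ue : EuclideanSpace ℝ (Fin l)
  ν : EuclideanSpace ℝ (Fin n)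
  c : ℝ
  posSemidef : P.PosSemidef
  riccati : riccatiMap p.A p.B (p.Q₁ + p.Q₂) (p.R₁ + p.R₂) P = P
  steady : p.IsSteadyState w xe ue
  multiplier : p.IsLagrangeMultiplier xe ue ν
  storage : IsStrictStorage p.A p.B p.Q₁ p.R₁ S c

lemma IsConvex.nonempty_certificate (h : p.IsConvex) (hstab : IsStabilizable p.A p.B)
    (hdet : IsDetectable p.A (psdSqrt p.Q₁)) {w : EuclideanSpace ℝ (Fin m)}
    (hsteady : ∃ x u, p.IsSteadyState w x u) : Nonempty (p.Certificate w) := by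
  obtain ⟨P, hP, hric⟩ := hstab.exists_riccatiMap_eq
    (h.posSemidef_Q₁.add h.posSemidef_Q₂) h.posDef_add
  obtain ⟨S, c, hS⟩ := hdet.exists_isStrictStorage (B := p.B) h.posSemidef_Q₁ h.posDef_R₁
  obtain ⟨xe, ue, ν, hxu, hν⟩ := exists_isLagrangeMultiplier h.posSemidef_Q₁.1 h.posDef_R₁ hS
    hsteady
  exact ⟨P, S, xe, ue, ν, c, hP, hric, hxu, hν, hS⟩

namespace Certificate

variable {w : EuclideanSpace ℝ (Fin m)} (C : p.Certificate w)

/-- The closed-loop matrix of the Riccati feedback. -/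
noncomputable def closedLoop : Matrix (Fin n) (Fin n) ℝ := p.A + p.B * p.gain C.P

lemma isRiccatiSolution : p.IsRiccatiSolution C.P := ⟨C.posSemidef, C.riccati.symm⟩

/-- The integrand of the storage function, where `d` is the deviation of the state from the
stationary state and `y` that of the stationary state from its mean. -/
noncomputable def storageDensity (d y : EuclideanSpace ℝ (Fin n)) : ℝ :=
  ⟪C.ν, d⟫ - 2 * ⟪d, y⟫[C.P] + ⟪d, d⟫[C.S]

/-- The storage at the random state `X` relative to the stationary state `Xs`. -/
noncomputable def storageAt {Ω : Type*} [MeasurableSpace Ω] (μ : Measure Ω)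
    (Xs X : Ω → EuclideanSpace ℝ (Fin n)) : ℝ :=
  ∫ ω, C.storageDensity (X ω - Xs ω) (Xs ω - C.xe) ∂μ

lemma storageDensity_add (d y e : EuclideanSpace ℝ (Fin n)) :
    C.storageDensity d (y + e) = C.storageDensity d y - 2 * ⟪d, e⟫[C.P] := by
  simp only [storageDensity, map_add, inner_add_right d]
  ring

lemma le_detStageCost_sub (hp : p.IsConvex) (x xs : EuclideanSpace ℝ (Fin n))
    (u us : EuclideanSpace ℝ (Fin l)) (hus : us = toEuclideanLin (p.gain C.P) (xs - C.xe) + C.ue) :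
    C.c * ‖x - xs‖ ^ 2 ≤ p.detStageCost x u - p.detStageCost xs us +
      2 * ⟪x - xs, xs - C.xe⟫[p.Q₂] + 2 * ⟪u - us, us - C.ue⟫[p.R₂] +
      C.storageDensity (x - xs) (xs - C.xe) -
      C.storageDensity (toEuclideanLin p.A (x - xs) + toEuclideanLin p.B (u - us))
        (toEuclideanLin C.closedLoop (xs - C.xe)) := by
  have hsupply := C.storage.le_supply (x - xs) (u - us)
  have hric := inner_riccati hp.posDef_add C.posSemidef C.riccati (x - xs) (xs - C.xe) (u - us)
  have hfeedback : us - C.ue = toEuclideanLin (p.gain C.P) (xs - C.xe) :=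
    sub_eq_iff_eq_add.2 hus
  have hmult := C.multiplier (x - xs) (u - us)
  rw [inner_sub_right C.ν] at hmult
  have hstate : ⟪x - xs, xs⟫[p.Q₁] = ⟪x - xs, xs - C.xe⟫[p.Q₁] + ⟪x - xs, C.xe⟫[p.Q₁] := by
    rw [← inner_add_right, ← map_add, sub_add_cancel]
  have hcontrol : ⟪u - us, us⟫[p.R₁] = ⟪u - us, us - C.ue⟫[p.R₁] + ⟪u - us, C.ue⟫[p.R₁] := by
    rw [← inner_add_right, ← map_add, sub_add_cancel]
  change ⟪x - xs, xs - C.xe⟫[C.P] = ⟪x - xs, xs - C.xe⟫[p.Q₁ + p.Q₂] +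
    ⟪u - us, toEuclideanLin (p.gain C.P) (xs - C.xe)⟫[p.R₁ + p.R₂] +
    ⟪_, toEuclideanLin C.closedLoop (xs - C.xe)⟫[C.P] at hric
  rw [← hfeedback, map_add, LinearMap.add_apply, inner_add_right, map_add, LinearMap.add_apply,
    inner_add_right] at hric
  rw [detStageCost_sub hp.posSemidef_Q₁.1 hp.posDef_R₁.1, hstate, hcontrol]
  simp only [storageDensity]
  linarith

lemma exists_neg_mul_le_storageDensity :
    ∃ b : ℝ, ∀ d y, -b * ‖C.ν - (2 : ℝ) • toEuclideanLin C.P y‖ ^ 2 ≤ C.storageDensity d y := by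
  obtain ⟨s, hs, hsS⟩ := exists_pos_mul_norm_sq_le C.storage.posDef
  refine ⟨(4 * s)⁻¹, fun d y => ?_⟩
  set a := C.ν - (2 : ℝ) • toEuclideanLin C.P y with ha
  have hlin : ⟪C.ν, d⟫ - 2 * ⟪d, y⟫[C.P] = ⟪d, a⟫ := by
    rw [ha, inner_sub_right, real_inner_smul_right, real_inner_comm]
  calc -(4 * s)⁻¹ * ‖a‖ ^ 2
      ≤ (4 * s)⁻¹ * ‖(2 * s) • d + a‖ ^ 2 - (4 * s)⁻¹ * ‖a‖ ^ 2 := by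
        rw [neg_mul, neg_eq_zero_sub]
        gcongr
        positivity
    _ = ⟪d, a⟫ + s * ‖d‖ ^ 2 := by
        rw [norm_add_sq_real, norm_smul, real_inner_smul_left, Real.norm_of_nonneg (by positivity)]
        field_simp
        ring
    _ ≤ C.storageDensity d y := by
        rw [storageDensity, hlin]
        gcongr
        exact hsS d

section Stochastic

variable {Ω : Type*} [MeasurableSpace Ω] {μ : Measure Ω} [IsProbabilityMeasure μ]

lemma integrable_storageDensity {D Y : Ω → EuclideanSpace ℝ (Fin n)} (hD : MemLp D 2 μ)
    (hY : MemLp Y 2 μ) : Integrable (fun ω => C.storageDensity (D ω) (Y ω)) μ :=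
  ((integrable_inner_of_memLp (memLp_const C.ν) hD).sub
    ((integrable_inner_toEuclideanLin C.P hD hY).const_mul 2)).add
    (integrable_inner_toEuclideanLin C.S hD hD)

lemma exists_neg_mul_integral_le_storageAt :
    ∃ b : ℝ, ∀ Xs X, MemLp Xs 2 μ → MemLp X 2 μ →
      -b * ∫ ω, ‖C.ν - (2 : ℝ) • toEuclideanLin C.P (Xs ω - C.xe)‖ ^ 2 ∂μ ≤
        C.storageAt μ Xs X := by
  obtain ⟨b, hb⟩ := C.exists_neg_mul_le_storageDensity
  refine ⟨b, fun Xs X hXs hX => ?_⟩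
  have hY : MemLp (fun ω => Xs ω - C.xe) 2 μ := hXs.sub (memLp_const _)
  have hN : MemLp (fun ω => C.ν - (2 : ℝ) • toEuclideanLin C.P (Xs ω - C.xe)) 2 μ :=
    (memLp_const C.ν).sub ((memLp_toEuclideanLin C.P hY).const_smul (2 : ℝ))
  rw [← integral_const_mul]
  exact integral_mono ((hN.integrable_norm_pow two_ne_zero).const_mul _)
    (C.integrable_storageDensity (hX.sub hXs) hY) fun ω => hb _ _

variable {W : ℕ → Ω → EuclideanSpace ℝ (Fin m)} {ϱ : Measure (EuclideanSpace ℝ (Fin n))}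
  {Xs : ℕ → Ω → EuclideanSpace ℝ (Fin n)} {Us : ℕ → Ω → EuclideanSpace ℝ (Fin l)}
  {X : Ω → EuclideanSpace ℝ (Fin n)} {U : Ω → EuclideanSpace ℝ (Fin l)} {k : ℕ}

lemma storageAt_succ {C : p.Certificate (∫ ω, W k ω ∂μ)}
    (hsol : p.IsFeedbackSolution μ W (p.gain C.P) C.xe C.ue ϱ Xs Us) (hXs : MemLp (Xs k) 2 μ)
    (hW : MemLp (W k) 2 μ) (hX : MemLp X 2 μ) (hU : MemLp U 2 μ)
    (hXW : IndepFun X (W k) μ) (hUW : IndepFun U (W k) μ) :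
    C.storageAt μ (Xs (k + 1)) (fun ω => p.f (X ω) (U ω) (W k ω)) =
      ∫ ω, C.storageDensity
        (toEuclideanLin p.A (X ω - Xs k ω) + toEuclideanLin p.B (U ω - Us k ω))
        (toEuclideanLin C.closedLoop (Xs k ω - C.xe)) ∂μ := by
  have hUs := hsol.memLp_control hXs
  set D := fun ω => toEuclideanLin p.A (X ω - Xs k ω) + toEuclideanLin p.B (U ω - Us k ω)
  set Y := fun ω => toEuclideanLin C.closedLoop (Xs k ω - C.xe)
  set e := fun ω => toEuclideanLin p.E (W k ω - ∫ ω', W k ω' ∂μ)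
  have hD : MemLp D 2 μ :=
    (memLp_toEuclideanLin p.A (hX.sub hXs)).add (memLp_toEuclideanLin p.B (hU.sub hUs))
  have hY : MemLp Y 2 μ := memLp_toEuclideanLin C.closedLoop (hXs.sub (memLp_const C.xe))
  have he : MemLp e 2 μ := memLp_toEuclideanLin p.E (hW.sub (memLp_const _))
  have hstep : (fun ω => C.storageDensity (p.f (X ω) (U ω) (W k ω) - Xs (k + 1) ω)
      (Xs (k + 1) ω - C.xe)) =ᵐ[μ]
      fun ω => C.storageDensity (D ω) (Y ω) - 2 * ⟪D ω, e ω⟫[C.P] := by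
    filter_upwards [hsol.feedback k, hsol.step k] with ω hfeedback hnext
    have hYe : Xs (k + 1) ω - C.xe = Y ω + e ω := by
      rw [hnext, hfeedback]
      exact C.steady.feedbackStep_sub _ _
    rw [hYe, storageDensity_add, hnext, f_sub_f, sub_self, map_zero, add_zero]
  have hcross : ∫ ω, ⟪D ω, e ω⟫[C.P] ∂μ = 0 := integral_cross_eq_zero C.P hX hXs hU hUs hW hXW
    (hsol.indep k) hUW (hsol.indepFun_control k)
  rw [storageAt, integral_congr_ae hstep, integral_sub (C.integrable_storageDensity hD hY)
    ((integrable_inner_toEuclideanLin C.P hD he).const_mul 2), integral_const_mul, hcross,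
    mul_zero, sub_zero]

lemma dissipation_inequality (hp : p.IsConvex) {C : p.Certificate (∫ ω, W k ω ∂μ)}
    (hsol : p.IsFeedbackSolution μ W (p.gain C.P) C.xe C.ue ϱ Xs Us) (hXs : MemLp (Xs k) 2 μ)
    (hmean : ∫ ω, Xs k ω ∂μ = C.xe) (hW : MemLp (W k) 2 μ) (hX : MemLp X 2 μ) (hU : MemLp U 2 μ)
    (hXW : IndepFun X (W k) μ) (hUW : IndepFun U (W k) μ) :
    C.c * ∫ ω, ‖X ω - Xs k ω‖ ^ 2 ∂μ ≤ p.stageCost μ X U - p.stageCost μ (Xs k) (Us k) +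
      C.storageAt μ (Xs k) X -
      C.storageAt μ (Xs (k + 1)) (fun ω => p.f (X ω) (U ω) (W k ω)) := by
  have hUs := hsol.memLp_control hXs
  have hD : MemLp (fun ω => X ω - Xs k ω) 2 μ := hX.sub hXs
  have hV : MemLp (fun ω => U ω - Us k ω) 2 μ := hU.sub hUs
  have hXsc : MemLp (fun ω => Xs k ω - C.xe) 2 μ := hXs.sub (memLp_const _)
  have hUsc : MemLp (fun ω => Us k ω - C.ue) 2 μ := hUs.sub (memLp_const _)
  have hcost := (integrable_detStageCost p hX hU).sub (integrable_detStageCost p hXs hUs)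
  have hcovX := (integrable_inner_toEuclideanLin p.Q₂ hD hXsc).const_mul 2
  have hcovU := (integrable_inner_toEuclideanLin p.R₂ hV hUsc).const_mul 2
  have hnow := C.integrable_storageDensity hD hXsc
  have hD' : MemLp (fun ω => toEuclideanLin p.A (X ω - Xs k ω) +
      toEuclideanLin p.B (U ω - Us k ω)) 2 μ :=
    (memLp_toEuclideanLin p.A hD).add (memLp_toEuclideanLin p.B hV)
  have hnext := C.integrable_storageDensity hD' (memLp_toEuclideanLin C.closedLoop hXsc)
  have hX_le := integral_inner_sub_le_trace_mul_covMatrix_sub hp.posSemidef_Q₂ hX hXs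
  have hU_le := integral_inner_sub_le_trace_mul_covMatrix_sub hp.posSemidef_R₂ hU hUs
  rw [hmean] at hX_le
  rw [hsol.integral_control (hXs.integrable one_le_two) hmean] at hU_le
  have hint := integral_mono_ae ((hD.integrable_norm_pow two_ne_zero).const_mul C.c)
    ((((hcost.add hcovX).add hcovU).add hnow).sub hnext)
    ((hsol.feedback k).mono fun ω hω =>
      C.le_detStageCost_sub hp (X ω) (Xs k ω) (U ω) (Us k ω) hω)
  rw [integral_const_mul, integral_sub' (((hcost.add hcovX).add hcovU).add hnow) hnext,
    integral_add' ((hcost.add hcovX).add hcovU) hnow, integral_add' (hcost.add hcovX) hcovU,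
    integral_add' hcost hcovX,
    integral_sub' (integrable_detStageCost p hX hU) (integrable_detStageCost p hXs hUs)] at hint
  rw [storageAt_succ hsol hXs hW hX hU hXW hUW]
  unfold stageCost storageAt
  linarith

end Stochastic

end Certificate
end LQProblem
end Dissipativity

section Recursion

variable {α β Ω : Type*} [MeasurableSpace α] [MeasurableSpace β] [MeasurableSpace Ω]
  {μ : Measure Ω}

/-- `ϱ` is a stationary law of the random recursion `x ↦ g x w` driven by noise with law `ν`. -/
def IsStationaryLaw (g : α → β → α) (ν : Measure β) (ϱ : Measure α) : Prop :=
  (ϱ.prod ν).map (Function.uncurry g) = ϱ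

lemma IsStationaryLaw.hasLaw [IsFiniteMeasure μ] {g : α → β → α} {ν : Measure β} {ϱ : Measure α}
    (hϱ : IsStationaryLaw g ν ϱ) (hg : Measurable (Function.uncurry g)) {X : ℕ → Ω → α}
    {W : ℕ → Ω → β} (hX : HasLaw (X 0) ϱ μ) (hW : ∀ k, HasLaw (W k) ν μ)
    (hXW : ∀ k, IndepFun (X k) (W k) μ) (hstep : ∀ k, X (k + 1) =ᵐ[μ] fun ω => g (X k ω) (W k ω))
    (k : ℕ) : HasLaw (X k) ϱ μ := by
  induction k with
  | zero => exact hX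
  | succ k ih =>
    have hpair : HasLaw (fun ω => (X k ω, W k ω)) (ϱ.prod ν) μ := by
      have := ih.isFiniteMeasure_iff.1 ‹_›
      have := (hW k).isFiniteMeasure_iff.1 ‹_›
      exact (indepFun_iff_hasLaw_prodMk_prod ih (hW k)).1 (hXW k)
    exact (HasLaw.fun_comp ⟨hg.aemeasurable, hϱ⟩ hpair).congr (hstep k)

lemma indepFun_tail {W : ℕ → Ω → β} (hW : ∀ k, Measurable (W k)) (h : iIndepFun W μ) (k : ℕ) :
    IndepFun (W k) (fun ω j => W (j + k + 1) ω) μ := by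
  have hind := indep_iSup_of_disjoint (fun i => (hW i).comap_le) h
    (S := {k}) (T := {i | k < i}) (by simp)
  rw [IndepFun_iff_Indep]
  refine indep_of_indep_of_le_right (indep_of_indep_of_le_left hind (by simp)) ?_
  rw [MeasurableSpace.pi, MeasurableSpace.comap_iSup]
  refine iSup_le fun j => ?_
  rw [MeasurableSpace.comap_comp]
  exact le_iSup₂_of_le (j + k + 1) (by simp only [Set.mem_ofPred_eq]; omega) le_rfl

end Recursion

section AffineRecursion

open scoped ENNReal

variable {E Ω β : Type*} [NormedAddCommGroup E] [NormedSpace ℝ E] [MeasurableSpace Ω]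
  [MeasurableSpace β] {μ : Measure Ω} {ν : Measure β} {L : E →L[ℝ] E} {q : ℝ≥0∞}

omit [NormedSpace ℝ E] in
lemma exists_memLp_ae_hasSum [CompleteSpace E] [Fact (1 ≤ q)] {V : ℕ → Ω → E}
    (hV : ∀ j, MemLp (V j) q μ) (hsum : ∑' j, eLpNorm (V j) q μ ≠ ⊤) :
    ∃ Y, MemLp Y q μ ∧ ∀ᵐ ω ∂μ, HasSum (fun j => V j ω) (Y ω) := by
  have hsum' : ∑' j, ‖(hV j).toLp (V j)‖ₑ ≠ ⊤ := by simpa only [Lp.enorm_toLp] using hsum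
  refine ⟨_, Lp.memLp (∑' j, (hV j).toLp (V j)), ?_⟩
  filter_upwards [Lp.hasSum_coeFn_tsum hsum', ae_all_iff.2 fun j => (hV j).coeFn_toLp]
    with ω hω hcoe
  simpa only [hcoe] using hω

/-- The solution is the series `∑ⱼ Lʲ (F (Tʲ ω))`. -/
lemma exists_memLp_ae_eq_add_comp [CompleteSpace E] [Fact (1 ≤ q)] {T : Ω → Ω}
    (hT : MeasurePreserving T μ μ) (hL : Summable fun k => ‖L ^ k‖) {F : Ω → E}
    (hF : MemLp F q μ) : ∃ Y, MemLp Y q μ ∧ Y =ᵐ[μ] fun ω => L (Y (T ω)) + F ω := by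
  let V : ℕ → Ω → E := fun j ω => (L ^ j) (F (T^[j] ω))
  have hFT : ∀ j, MemLp (F ∘ T^[j]) q μ := fun j => hF.comp_measurePreserving (hT.iterate j)
  have hV : ∀ j, MemLp (V j) q μ := fun j => (L ^ j).comp_memLp' (hFT j)
  have hle : ∀ j, eLpNorm (V j) q μ ≤ ENNReal.ofReal ‖L ^ j‖ * eLpNorm F q μ := fun j => by
    rw [← eLpNorm_comp_measurePreserving hF.aestronglyMeasurable (hT.iterate j)]
    exact eLpNorm_le_mul_eLpNorm_of_ae_le_mul (ae_of_all _ fun ω => (L ^ j).le_opNorm _) q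
  obtain ⟨Y, hY, hsum⟩ := exists_memLp_ae_hasSum hV <|
    ne_top_of_le_ne_top (ENNReal.mul_ne_top hL.tsum_ofReal_ne_top hF.eLpNorm_ne_top)
      ((ENNReal.tsum_le_tsum hle).trans_eq ENNReal.tsum_mul_right)
  refine ⟨Y, hY, ?_⟩
  filter_upwards [hsum, hT.quasiMeasurePreserving.ae hsum] with ω hω hTω
  have hshift : HasSum (fun j => V (j + 1) ω) (L (Y (T ω))) := by
    simpa only [V, pow_succ', Function.iterate_succ_apply, mul_apply_eq_comp] using L.hasSum hTω
  simpa [V] using hω.unique ((hasSum_nat_add_iff 1).1 hshift)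

lemma measurePreserving_shift [IsProbabilityMeasure ν] :
    MeasurePreserving (fun (z : ℕ → β) j => z (j + 1)) (Measure.infinitePi fun _ => ν)
      (Measure.infinitePi fun _ => ν) :=
  ⟨by fun_prop, Measure.map_infinitePi_infinitePi_of_inj (P := fun _ : ℕ => ν)
    (add_left_injective 1)⟩

lemma exists_isStationaryLaw_affine [CompleteSpace E] [MeasurableSpace E] [BorelSpace E]
    [SecondCountableTopology E] [IsProbabilityMeasure ν] [Fact (1 ≤ q)]
    (hL : Summable fun k => ‖L ^ k‖) {h : β → E} (hh : Measurable h) (hmem : MemLp h q ν) :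
    ∃ ϱ, IsProbabilityMeasure ϱ ∧ MemLp id q ϱ ∧ IsStationaryLaw (fun x w => L x + h w) ν ϱ := by
  let μ := Measure.infinitePi fun _ : ℕ => ν
  let T : (ℕ → β) → ℕ → β := fun z j => z (j + 1)
  have hT : MeasurePreserving T μ μ := measurePreserving_shift
  have heval : MeasurePreserving (fun z : ℕ → β => z 0) μ ν := measurePreserving_eval_infinitePi _ 0
  obtain ⟨Y, hY, hYT⟩ := exists_memLp_ae_eq_add_comp hT hL (hmem.comp_measurePreserving heval)
  have hYm := hY.aestronglyMeasurable.aemeasurable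
  have hlaw : HasLaw Y (μ.map Y) μ := ⟨hYm, rfl⟩
  have hϱ := Measure.isProbabilityMeasure_map hYm
  have hindep : IndepFun (fun z => Y (T z)) (fun z => z 0) μ := by
    have hcoord : iIndepFun (fun k (z : ℕ → β) => z k) μ :=
      iIndepFun_infinitePi (X := fun _ => id) fun _ => measurable_id
    exact (indepFun_tail measurable_pi_apply hcoord 0).symm.comp₀ hT.aemeasurable
      heval.aemeasurable (hT.map_eq.symm ▸ hYm) aemeasurable_id
  have hpair := (indepFun_iff_hasLaw_prodMk_prod (hlaw.fun_comp hT.hasLaw) heval.hasLaw).1 hindep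
  refine ⟨μ.map Y, hϱ, (memLp_map_measure_iff aestronglyMeasurable_id hYm).2 hY, ?_⟩
  have hg : Measurable (Function.uncurry fun x w => L x + h w) := by fun_prop
  rw [IsStationaryLaw, ← hpair.map_eq, AEMeasurable.map_map_of_aemeasurable hg.aemeasurable
    hpair.aemeasurable]
  exact Measure.map_congr hYT.symm

lemma IsStationaryLaw.integral_eq [CompleteSpace E] [MeasurableSpace E] [BorelSpace E]
    [SecondCountableTopology E] [IsProbabilityMeasure ν] {ϱ : Measure E} [IsProbabilityMeasure ϱ]
    {h : β → E} (hϱ : IsStationaryLaw (fun x w => L x + h w) ν ϱ) (hh : Measurable h)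
    (hint : Integrable h ν) (hid : Integrable id ϱ) :
    ∫ x, x ∂ϱ = L (∫ x, x ∂ϱ) + ∫ w, h w ∂ν := by
  have hg : Measurable (Function.uncurry fun x w => L x + h w) := by fun_prop
  have hLx : Integrable (fun x => L x) ϱ := L.integrable_comp hid
  calc ∫ x, x ∂ϱ = ∫ y, L y.1 + h y.2 ∂ϱ.prod ν := by
        nth_rewrite 1 [← hϱ]
        exact integral_map hg.aemeasurable aestronglyMeasurable_id
    _ = ∫ x, L x ∂ϱ + ∫ w, h w ∂ν := by
        rw [integral_add (hLx.comp_fst ν) (hint.comp_snd ϱ), integral_fun_fst, integral_fun_snd]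
        simp
    _ = L (∫ x, x ∂ϱ) + ∫ w, h w ∂ν := congrArg (· + _) (L.integral_comp_comm hid)

lemma eq_of_map_sub_eq_self (hL : Summable fun k => ‖L ^ k‖) {x y : E} (h : L (x - y) = x - y) :
    x = y := by
  have hfix : ∀ k, (L ^ k) (x - y) = x - y := fun k => by
    induction k with
    | zero => rfl
    | succ k ih => rw [pow_succ, mul_apply_eq_comp, h, ih]
  have hlim : Tendsto (fun k => ‖L ^ k‖ * ‖x - y‖) atTop (𝓝 0) := by
    simpa using hL.tendsto_atTop_zero.mul_const ‖x - y‖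
  have hle : ‖x - y‖ ≤ 0 := ge_of_tendsto' hlim fun k => by
    simpa only [hfix] using (L ^ k).le_opNorm (x - y)
  exact sub_eq_zero.1 (norm_le_zero_iff.1 hle)

end AffineRecursion

section RecursionSolution

variable {Ω : Type*} [MeasurableSpace Ω] {μ : Measure Ω} [IsProbabilityMeasure μ]

lemma indepFun_prodMk_left {α β γ : Type*} [MeasurableSpace α] [MeasurableSpace β]
    [MeasurableSpace γ] {X : Ω → α} {Y : Ω → β} {Z : Ω → γ} (hX : AEMeasurable X μ)
    (hY : AEMeasurable Y μ) (hZ : AEMeasurable Z μ) (hX_YZ : IndepFun X (fun ω => (Y ω, Z ω)) μ)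
    (hYZ : IndepFun Y Z μ) : IndepFun (fun ω => (X ω, Y ω)) Z μ := by
  have := Measure.isProbabilityMeasure_map hX
  have := Measure.isProbabilityMeasure_map hY
  have := Measure.isProbabilityMeasure_map hZ
  have lawX : HasLaw X (μ.map X) μ := ⟨hX, rfl⟩
  have lawY : HasLaw Y (μ.map Y) μ := ⟨hY, rfl⟩
  have lawZ : HasLaw Z (μ.map Z) μ := ⟨hZ, rfl⟩
  have hXY : IndepFun X Y μ := hX_YZ.comp measurable_id measurable_fst
  have lawXYZ := (hX_YZ.hasLaw_prod lawX (hYZ.hasLaw_prod lawY lawZ))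
  rw [indepFun_iff_hasLaw_prodMk_prod (hXY.hasLaw_prod lawX lawY) lawZ]
  exact (measurePreserving_prodAssoc _ _ _).symm.comp_hasLaw lawXYZ

lemma indepFun_of_recursion {α β : Type*} [MeasurableSpace α] [MeasurableSpace β]
    {W : ℕ → Ω → β} (hW : ∀ k, Measurable (W k)) (hWindep : iIndepFun W μ) {g : α → β → α}
    (hg : Measurable (Function.uncurry g)) {X : ℕ → Ω → α} (hX : AEMeasurable (X 0) μ)
    (hXW : IndepFun (X 0) (fun ω k => W k ω) μ) (hstep : ∀ k ω, X (k + 1) ω = g (X k ω) (W k ω))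
    (k : ℕ) : AEMeasurable (X k) μ ∧ IndepFun (X k) (fun ω j => W (j + k) ω) μ := by
  induction k with
  | zero => exact ⟨hX, hXW⟩
  | succ k ih =>
    obtain ⟨hXk, hindep⟩ := ih
    have htail : Measurable fun ω j => W (j + k + 1) ω := measurable_pi_lambda _ fun j => hW _
    have hsplit : IndepFun (X k) (fun ω => (W k ω, fun j => W (j + k + 1) ω)) μ := by
      simpa [Function.comp_def, add_right_comm] using
        hindep.comp (φ := id) (ψ := fun s : ℕ → β => (s 0, fun j => s (j + 1))) measurable_id
          (by fun_prop)
    have hpair := indepFun_prodMk_left hXk (hW k).aemeasurable htail.aemeasurable hsplit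
      (indepFun_tail hW hWindep k)
    rw [show X (k + 1) = Function.uncurry g ∘ fun ω => (X k ω, W k ω) from funext (hstep k)]
    exact ⟨hg.comp_aemeasurable (hXk.prodMk (hW k).aemeasurable), hpair.comp hg measurable_id⟩

omit [IsProbabilityMeasure μ] in
lemma exists_hasLaw_of_uniform {β : Type*} [MeasurableSpace β] [StandardBorelSpace β] [Nonempty β]
    (ϱ : Measure β) [IsProbabilityMeasure ϱ] {ξ : Ω → ℝ}
    (hξ : HasLaw ξ (volume.restrict (Set.Icc 0 1)) μ) :
    ∃ g : ℝ → β, Measurable g ∧ HasLaw (fun ω => g (ξ ω)) ϱ μ := by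
  obtain ⟨g, hg, hmap⟩ := ϱ.exists_measurable_map_eq
  let π : ℝ → Set.Icc (0 : ℝ) 1 := Set.projIcc 0 1 zero_le_one
  have hπ : Measurable π := continuous_projIcc.measurable
  have hlaw : HasLaw π volume (volume.restrict (Set.Icc 0 1)) := by
    refine ⟨hπ.aemeasurable, ?_⟩
    rw [← (measurePreserving_subtype_coe measurableSet_Icc).map_eq,
      Measure.map_map hπ measurable_subtype_coe,
      show π ∘ Subtype.val = id from funext (Set.projIcc_val zero_le_one), Measure.map_id]
    rfl
  exact ⟨g ∘ π, hg.comp hπ, (HasLaw.comp ⟨hg.aemeasurable, hmap⟩ hlaw).comp hξ⟩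

lemma LQProblem.exists_isFeedbackSolution {n l m : ℕ} {p : LQProblem n l m}
    {K : Matrix (Fin l) (Fin n) ℝ} {xe : EuclideanSpace ℝ (Fin n)} {ue : EuclideanSpace ℝ (Fin l)}
    {W : ℕ → Ω → EuclideanSpace ℝ (Fin m)} (hW : ∀ k, Measurable (W k)) (hWindep : iIndepFun W μ)
    (ϱ : Measure (EuclideanSpace ℝ (Fin n))) [IsProbabilityMeasure ϱ] {ξ : Ω → ℝ}
    (hξ : HasLaw ξ (volume.restrict (Set.Icc 0 1)) μ)
    (hξW : IndepFun ξ (fun ω k => W k ω) μ) :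
    ∃ Xs Us, p.IsFeedbackSolution μ W K xe ue ϱ Xs Us := by
  obtain ⟨g, hg, hlaw⟩ := exists_hasLaw_of_uniform ϱ hξ
  let X : ℕ → Ω → EuclideanSpace ℝ (Fin n) := fun k => Nat.rec (fun ω => g (ξ ω))
    (fun k x ω => p.f (x ω) (toEuclideanLin K (x ω - xe) + ue) (W k ω)) k
  have hindep := indepFun_of_recursion hW hWindep (p.measurable_feedbackStep K xe ue) (X := X)
    hlaw.aemeasurable (hξW.comp hg measurable_id) fun k ω => rfl
  refine ⟨X, fun k ω => toEuclideanLin K (X k ω - xe) + ue, hlaw,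
    fun k => ?_, fun k => ae_eq_rfl, fun k => ae_eq_rfl⟩
  simpa [Function.comp_def] using
    (hindep k).2.comp measurable_id (measurable_pi_apply 0)

end RecursionSolution

section StationarySolution

lemma IsStrictStorage.mono {n l : Type*} [Fintype n] [DecidableEq n] [Fintype l] [DecidableEq l]
    {A Q Q' S : Matrix n n ℝ} {B : Matrix n l ℝ} {R R' : Matrix l l ℝ} {c : ℝ}
    (h : IsStrictStorage A B Q R S c) (hQ : Q ≤ Q') (hR : R ≤ R') :
    IsStrictStorage A B Q' R' S c where
  posDef := h.posDef
  rate_pos := h.rate_pos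
  le_supply x u := by
    linarith [h.le_supply x u, inner_toEuclideanLin_mono hQ x, inner_toEuclideanLin_mono hR u]

lemma isKInfty_const_mul {c : ℝ} (hc : 0 < c) : IsKInfty fun r => c * r where
  continuousOn := (continuous_const_mul c).continuousOn
  strictMonoOn := (strictMono_mul_left_of_pos hc).strictMonoOn _
  map_zero := mul_zero c
  unbounded M := ⟨(|M| + 1) / c, by positivity, by
    rw [mul_div_cancel₀ _ hc.ne']
    linarith [le_abs_self M]⟩

section SecondMoments

variable {Ω : Type*} [MeasurableSpace Ω] {μ : Measure Ω}

lemma memLp_iff_memLp_id_of_hasLaw {F : Type*} [NormedAddCommGroup F] [MeasurableSpace F]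
    [BorelSpace F] [SecondCountableTopology F] {q : ENNReal} {ϱ : Measure F} {X : Ω → F}
    (h : HasLaw X ϱ μ) : MemLp X q μ ↔ MemLp id q ϱ := by
  rw [← h.map_eq, memLp_map_measure_iff aestronglyMeasurable_id h.aemeasurable, Function.id_comp]

lemma isP2_of_memLp [IsProbabilityMeasure μ] {d : ℕ} {ϱ : Measure (EuclideanSpace ℝ (Fin d))}
    {X : Ω → EuclideanSpace ℝ (Fin d)} (h : HasLaw X ϱ μ) (hX : MemLp X 2 μ) : IsP2 ϱ := by
  refine ⟨h.isProbabilityMeasure_iff.1 inferInstance, ?_⟩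
  rw [← h.lintegral_comp (f := fun x => ‖x‖ₑ ^ 2) (by fun_prop)]
  simpa using (eLpNorm_lt_top_iff_lintegral_rpow_enorm_lt_top two_ne_zero
    ENNReal.ofNat_ne_top).1 hX.eLpNorm_lt_top

end SecondMoments

namespace LQProblem

variable {n l m : ℕ} {p : LQProblem n l m}

namespace IsFeedbackSolution

variable {Ω : Type*} [MeasurableSpace Ω] {μ : Measure Ω} {W : ℕ → Ω → EuclideanSpace ℝ (Fin m)}
  {K : Matrix (Fin l) (Fin n) ℝ} {xe : EuclideanSpace ℝ (Fin n)} {ue : EuclideanSpace ℝ (Fin l)}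
  {ϱ : Measure (EuclideanSpace ℝ (Fin n))} {Xs : ℕ → Ω → EuclideanSpace ℝ (Fin n)}
  {Us : ℕ → Ω → EuclideanSpace ℝ (Fin l)}

lemma hasLaw [IsFiniteMeasure μ] (h : p.IsFeedbackSolution μ W K xe ue ϱ Xs Us)
    {ν : Measure (EuclideanSpace ℝ (Fin m))} (hW : ∀ k, HasLaw (W k) ν μ)
    (hϱ : IsStationaryLaw (p.feedbackStep K xe ue) ν ϱ) (k : ℕ) : HasLaw (Xs k) ϱ μ :=
  hϱ.hasLaw (p.measurable_feedbackStep K xe ue) h.law_zero hW h.indep (fun k => by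
    filter_upwards [h.feedback k, h.step k] with ω hfeedback hnext
    rw [hnext, hfeedback, feedbackStep]) k

lemma isStationaryPair [IsProbabilityMeasure μ] (h : p.IsFeedbackSolution μ W K xe ue ϱ Xs Us)
    (hlaw : ∀ k, HasLaw (Xs k) ϱ μ) (hϱ : MemLp id 2 ϱ) : p.IsStationaryPair μ W Xs Us := by
  have hX : MemLp (Xs 0) 2 μ := (memLp_iff_memLp_id_of_hasLaw (hlaw 0)).2 hϱ
  have hcontrol : ∀ k, HasLaw (Us k) (ϱ.map fun x => toEuclideanLin K (x - xe) + ue) μ := fun k =>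
    (HasLaw.fun_comp ⟨by fun_prop, rfl⟩ (hlaw k)).congr (h.feedback k)
  exact ⟨ϱ, _, isP2_of_memLp (hlaw 0) hX, isP2_of_memLp (hcontrol 0) (h.memLp_control hX),
    fun k => ⟨hlaw k, hcontrol k, h.indep k, h.indepFun_control k, h.step k⟩⟩

end IsFeedbackSolution

namespace Certificate

variable {w : EuclideanSpace ℝ (Fin m)} (C : p.Certificate w)

lemma isOptimalSteadyState (hp : p.IsConvex) : p.IsOptimalSteadyState w C.xe C.ue :=
  C.multiplier.isOptimalSteadyState hp.posSemidef_Q₁ hp.posDef_R₁.posSemidef C.steady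

open scoped Matrix.Norms.L2Operator in
lemma summable_norm_closedLoop_pow (hp : p.IsConvex) :
    Summable fun k => ‖toEuclideanCLM (𝕜 := ℝ) C.closedLoop ^ k‖ := by
  have hS := C.storage.mono (le_add_of_nonneg_right hp.posSemidef_Q₂.nonneg)
    (le_add_of_nonneg_right hp.posSemidef_R₂.nonneg)
  refine (hS.isLyapunov_closedLoop (hp.posSemidef_Q₁.add hp.posSemidef_Q₂).1 hp.posDef_add
    C.posSemidef C.riccati).summable_norm_pow.congr fun k => ?_
  rw [Matrix.cstar_norm_def, map_pow]
  rfl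

lemma feedbackStep_eq (x : EuclideanSpace ℝ (Fin n)) (w' : EuclideanSpace ℝ (Fin m)) :
    p.feedbackStep (p.gain C.P) C.xe C.ue x w' = toEuclideanCLM (𝕜 := ℝ) C.closedLoop x +
      (toEuclideanLin p.E (w' - w) + (C.xe - toEuclideanLin C.closedLoop C.xe)) := by
  have h := C.steady.feedbackStep_sub (K := p.gain C.P) x w'
  rw [sub_eq_iff_eq_add.1 h, map_sub]
  change toEuclideanLin C.closedLoop x - toEuclideanLin C.closedLoop C.xe + _ + _ =
    toEuclideanLin C.closedLoop x + _
  abel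

lemma exists_isStationaryLaw (hp : p.IsConvex) {ν : Measure (EuclideanSpace ℝ (Fin m))}
    [IsProbabilityMeasure ν] (hν : MemLp id 2 ν) (hmean : ∫ w', w' ∂ν = w) :
    ∃ ϱ : Measure (EuclideanSpace ℝ (Fin n)), IsProbabilityMeasure ϱ ∧ MemLp id 2 ϱ ∧
      ∫ x, x ∂ϱ = C.xe ∧ IsStationaryLaw (p.feedbackStep (p.gain C.P) C.xe C.ue) ν ϱ := by
  have hL := C.summable_norm_closedLoop_pow hp
  set L := toEuclideanCLM (𝕜 := ℝ) C.closedLoop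
  set h := fun w' => toEuclideanLin p.E (w' - w) + (C.xe - toEuclideanLin C.closedLoop C.xe)
  have hstep : p.feedbackStep (p.gain C.P) C.xe C.ue = fun x w' => L x + h w' :=
    funext₂ C.feedbackStep_eq
  have hnoise : MemLp (fun w' => toEuclideanLin p.E (w' - w)) 2 ν :=
    memLp_toEuclideanLin p.E (hν.sub (memLp_const w))
  have hh : MemLp h 2 ν := hnoise.add (memLp_const _)
  have hhmean : ∫ w', h w' ∂ν = C.xe - L C.xe := by
    have hcentered := integral_toEuclideanLin_centered p.E (hν.integrable one_le_two)
    simp only [id_eq, hmean] at hcentered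
    rw [integral_add (hnoise.integrable one_le_two) (integrable_const _), hcentered, zero_add,
      integral_const, probReal_univ, one_smul]
    rfl
  obtain ⟨ϱ, hprob, hϱ, hstat⟩ := exists_isStationaryLaw_affine hL (h := h) (by fun_prop) hh
  refine ⟨ϱ, hprob, hϱ, eq_of_map_sub_eq_self hL ?_, hstep ▸ hstat⟩
  have hfix := hstat.integral_eq (by fun_prop) (hh.integrable one_le_two)
    (hϱ.integrable one_le_two)
  rw [hhmean] at hfix
  rw [map_sub]
  nth_rewrite 2 [hfix]
  abel

lemma isStrictlyDissipativeWith {Ω : Type*} [MeasurableSpace Ω] {μ : Measure Ω}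
    [IsProbabilityMeasure μ] {W : ℕ → Ω → EuclideanSpace ℝ (Fin m)}
    {ϱ : Measure (EuclideanSpace ℝ (Fin n))} {Xs : ℕ → Ω → EuclideanSpace ℝ (Fin n)}
    {Us : ℕ → Ω → EuclideanSpace ℝ (Fin l)} (hp : p.IsConvex)
    (hsol : p.IsFeedbackSolution μ W (p.gain C.P) C.xe C.ue ϱ Xs Us)
    (hlaw : ∀ k, HasLaw (Xs k) ϱ μ) (hϱ : MemLp id 2 ϱ) (hmean : ∫ x, x ∂ϱ = C.xe)
    (hW : ∀ k, MemLp (W k) 2 μ) (hWmean : ∀ k, ∫ ω, W k ω ∂μ = w) :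
    p.IsStrictlyDissipativeWith μ W Xs Us fun r => C.c * r := by
  have hXs : ∀ k, MemLp (Xs k) 2 μ := fun k => (memLp_iff_memLp_id_of_hasLaw (hlaw k)).2 hϱ
  refine ⟨isKInfty_const_mul C.storage.rate_pos, fun k => C.storageAt μ (Xs k),
    fun k X Y hXY => ?_, ?_, fun k X U hX hU hXW hUW => ?_⟩
  · exact integral_congr_ae (hXY.mono fun ω hω => by simp only [hω])
  · obtain ⟨b, hb⟩ := C.exists_neg_mul_integral_le_storageAt (μ := μ)
    refine ⟨-b * ∫ x, ‖C.ν - (2 : ℝ) • toEuclideanLin C.P (x - C.xe)‖ ^ 2 ∂ϱ, fun k X hX => ?_⟩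
    have hcont : Measurable fun x => ‖C.ν - (2 : ℝ) • toEuclideanLin C.P (x - C.xe)‖ ^ 2 := by
      fun_prop
    rw [← (hlaw k).integral_comp hcont.aestronglyMeasurable]
    exact hb (Xs k) X (hXs k) hX
  · obtain rfl := hWmean k
    exact dissipation_inequality hp hsol (hXs k) ((hlaw k).integral_eq.trans hmean) (hW k) hX hU
      hXW hUW

end Certificate
end LQProblem

end StationarySolution

section Turnpike

variable {Ω : Type*} [MeasurableSpace Ω] {μ : Measure Ω}

lemma IsKInfty.nonneg {α : ℝ → ℝ} (hα : IsKInfty α) {r : ℝ} (hr : 0 ≤ r) : 0 ≤ α r :=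
  hα.map_zero.symm.trans_le (hα.strictMonoOn.monotoneOn Set.self_mem_Ici hr hr)

lemma sq_mul_lt_integral_norm_sq {F : Type*} [NormedAddCommGroup F] {D : Ω → F}
    (hD : MemLp D 2 μ) {ε η : ℝ} (hε : 0 < ε) (h : η < μ.real {ω | ε ≤ ‖D ω‖}) :
    ε ^ 2 * η < ∫ ω, ‖D ω‖ ^ 2 ∂μ := by
  have hset : {ω | ε ≤ ‖D ω‖} = {ω | ε ^ 2 ≤ ‖D ω‖ ^ 2} :=
    Set.ext fun ω => (sq_le_sq₀ hε.le (norm_nonneg _)).symm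
  calc ε ^ 2 * η < ε ^ 2 * μ.real {ω | ε ^ 2 ≤ ‖D ω‖ ^ 2} := by
        rw [← hset]
        gcongr
    _ ≤ ∫ ω, ‖D ω‖ ^ 2 ∂μ := mul_meas_ge_le_integral_of_nonneg
        (ae_of_all μ fun ω => sq_nonneg ‖D ω‖) (hD.integrable_norm_pow two_ne_zero) (ε ^ 2)

lemma sub_div_le_turnpikeCount {d : ℕ} {X Xs : ℕ → Ω → EuclideanSpace ℝ (Fin d)} {N : ℕ}
    {α : ℝ → ℝ} (hα : IsKInfty α) (hD : ∀ k < N, MemLp (fun ω => X k ω - Xs k ω) 2 μ) {b : ℝ}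
    (hsum : ∑ k ∈ Finset.range N, α (∫ ω, ‖X k ω - Xs k ω‖ ^ 2 ∂μ) ≤ b) {ε η : ℝ} (hε : 0 < ε)
    (hη : 0 < η) : N - b / α (ε ^ 2 * η) ≤ turnpikeCount μ X Xs N ε η := by
  classical
  have hr : 0 < ε ^ 2 * η := by positivity
  have hpos : 0 < α (ε ^ 2 * η) :=
    hα.map_zero.symm.trans_lt (hα.strictMonoOn Set.self_mem_Ici hr.le hr)
  set far := {k ∈ Finset.range N | η < μ.real {ω | ε ≤ ‖X k ω - Xs k ω‖}} with hfar
  have hcard : (turnpikeCount μ X Xs N ε η + far.card : ℝ) = N := by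
    have hsplit := Finset.card_filter_add_card_filter_not (s := Finset.range N)
      fun k => μ.real {ω | ε ≤ ‖X k ω - Xs k ω‖} ≤ η
    simp only [not_le, Finset.card_range] at hsplit
    rw [turnpikeCount]
    exact_mod_cast hsplit
  have hlarge : ∀ k ∈ far, α (ε ^ 2 * η) ≤ α (∫ ω, ‖X k ω - Xs k ω‖ ^ 2 ∂μ) := fun k hk => by
    rw [hfar, Finset.mem_filter, Finset.mem_range] at hk
    have hlt := sq_mul_lt_integral_norm_sq (hD k hk.1) hε hk.2
    exact hα.strictMonoOn.monotoneOn hr.le (hr.trans hlt).le hlt.le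
  have hcount : far.card * α (ε ^ 2 * η) ≤ b := calc
    far.card * α (ε ^ 2 * η) ≤ ∑ k ∈ far, α (∫ ω, ‖X k ω - Xs k ω‖ ^ 2 ∂μ) := by
        simpa using Finset.card_nsmul_le_sum _ _ _ hlarge
    _ ≤ ∑ k ∈ Finset.range N, α (∫ ω, ‖X k ω - Xs k ω‖ ^ 2 ∂μ) :=
        Finset.sum_le_sum_of_subset_of_nonneg (Finset.filter_subset _ _)
          fun k _ _ => hα.nonneg (by positivity)
    _ ≤ b := hsum
  linarith [(le_div_iff₀ hpos).2 hcount]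

namespace LQProblem

variable {n l m : ℕ} {p : LQProblem n l m} [IsProbabilityMeasure μ]
  {W : ℕ → Ω → EuclideanSpace ℝ (Fin m)} {X₀ : Ω → EuclideanSpace ℝ (Fin n)}

lemma IsAdmissible.memLp_traj {N : ℕ} {U : ℕ → Ω → EuclideanSpace ℝ (Fin l)}
    (hU : p.IsAdmissible μ W N X₀ U) (hW : ∀ k, MemLp (W k) 2 μ) (hX₀ : MemLp X₀ 2 μ) {k : ℕ}
    (hk : k ≤ N) : MemLp (p.traj W X₀ U k) 2 μ := by
  induction k with
  | zero => exact hX₀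
  | succ k ih => exact p.memLp_f (ih (by lia)) (hU.memLp k hk) (hW k)

lemma IsStrictlyDissipativeWith.exists_turnpike {Xs : ℕ → Ω → EuclideanSpace ℝ (Fin n)}
    {Us : ℕ → Ω → EuclideanSpace ℝ (Fin l)} {α : ℝ → ℝ}
    (h : p.IsStrictlyDissipativeWith μ W Xs Us α) (hW : ∀ k, MemLp (W k) 2 μ)
    (hXs : ∀ k, MemLp (Xs k) 2 μ) (hX₀ : MemLp X₀ 2 μ) :
    ∃ C : ℝ, ∀ (N : ℕ) (δ : ℝ) (U : ℕ → Ω → EuclideanSpace ℝ (Fin l)),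
      p.IsAdmissible μ W N X₀ U →
      p.cost μ W N X₀ U ≤ δ + ∑ k ∈ Finset.range N, p.stageCost μ (Xs k) (Us k) →
      ∀ ε η : ℝ, 0 < ε → 0 < η →
        N - (δ + C) / α (ε ^ 2 * η) ≤ turnpikeCount μ (p.traj W X₀ U) Xs N ε η := by
  obtain ⟨hα, stor, -, ⟨b, hb⟩, hdiss⟩ := h
  refine ⟨stor 0 X₀ - b, fun N δ U hU hcost ε η hε hη => ?_⟩
  set X := p.traj W X₀ U
  have hX : ∀ k ≤ N, MemLp (X k) 2 μ := fun k => hU.memLp_traj hW hX₀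
  refine sub_div_le_turnpikeCount hα (fun k hk => (hX k hk.le).sub (hXs k)) ?_ hε hη
  calc ∑ k ∈ Finset.range N, α (∫ ω, ‖X k ω - Xs k ω‖ ^ 2 ∂μ)
      ≤ ∑ k ∈ Finset.range N, (p.stageCost μ (X k) (U k) - p.stageCost μ (Xs k) (Us k) +
          (stor k (X k) - stor (k + 1) (X (k + 1)))) := by
        refine Finset.sum_le_sum fun k hk => ?_
        have hkN := Finset.mem_range.1 hk
        rw [← add_sub_assoc]
        exact hdiss k (X k) (U k) (hX k hkN.le) (hU.memLp k hkN) (hU.indep_state k hkN)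
          (hU.indep_control k hkN)
    _ = p.cost μ W N X₀ U - ∑ k ∈ Finset.range N, p.stageCost μ (Xs k) (Us k) +
          (stor 0 X₀ - stor N (X N)) := by
        rw [Finset.sum_add_distrib, Finset.sum_sub_distrib,
          Finset.sum_range_sub' fun k => stor k (X k)]
        rfl
    _ ≤ δ + (stor 0 X₀ - b) := by linarith [hb N (X N) (hX N le_rfl)]

end LQProblem

end Turnpike

end StochLQ

open StochLQ StochLQ.LQProblem in
theorem mainTheorem3 {n l m : ℕ} (p : StochLQ.LQProblem n l m)
    -- standing assumptions on the problem data
    (hstab : StochLQ.IsStabilizable p.A p.B)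
    (hQ₁ : p.Q₁.PosSemidef) (hQ₂ : p.Q₂.PosSemidef)
    (hR₁ : p.R₁.PosDef) (hR₂ : p.R₂.PosSemidef)
    -- the probability space and the i.i.d. square-integrable noise
    {Ω : Type*} [MeasurableSpace Ω] (μ : MeasureTheory.Measure Ω)
    [MeasureTheory.IsProbabilityMeasure μ]
    (W : ℕ → Ω → EuclideanSpace ℝ (Fin m))
    (hWmeas : ∀ k, Measurable (W k))
    (hWindep : ProbabilityTheory.iIndepFun W μ)
    (hWident : ∀ k, ProbabilityTheory.IdentDistrib (W k) (W 0) μ μ)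
    (hWL2 : ∀ k, MeasureTheory.MemLp (W k) 2 μ)
    -- existence of a deterministic steady state, and detectability
    (hsteady : ∃ xs us, p.IsSteadyState (∫ ω, W 0 ω ∂μ) xs us)
    (hdet : StochLQ.IsDetectable p.A (StochLQ.psdSqrt p.Q₁)) :
    ∃ (P : Matrix (Fin n) (Fin n) ℝ) (xe : EuclideanSpace ℝ (Fin n))
      (ue : EuclideanSpace ℝ (Fin l)) (ϱ : MeasureTheory.Measure (EuclideanSpace ℝ (Fin n)))
      (α : ℝ → ℝ),
      p.IsRiccatiSolution P ∧
      p.IsOptimalSteadyState (∫ ω, W 0 ω ∂μ) xe ue ∧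
      StochLQ.IsP2 ϱ ∧
      StochLQ.IsKInfty α ∧
      -- the stationary process exists if the probability space carries a uniform random variable
      -- that is independent of the noise
      ((∃ ξ : Ω → ℝ,
          ProbabilityTheory.HasLaw ξ (MeasureTheory.volume.restrict (Set.Icc 0 1)) μ ∧
          ProbabilityTheory.IndepFun ξ (fun ω k => W k ω) μ) →
        ∃ Xs Us, p.IsFeedbackSolution μ W (p.gain P) xe ue ϱ Xs Us) ∧
      -- every such process is stationary, the problem is strictly dissipative there, and it is a
      -- turnpike in probability
      ∀ Xs Us, p.IsFeedbackSolution μ W (p.gain P) xe ue ϱ Xs Us →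
        p.IsStationaryPair μ W Xs Us ∧
        p.IsStrictlyDissipativeWith μ W Xs Us α ∧
        ∀ X₀ : Ω → EuclideanSpace ℝ (Fin n), MeasureTheory.MemLp X₀ 2 μ →
          ∃ C : ℝ, ∀ (N : ℕ) (δ : ℝ), 0 < δ →
            ∀ U : ℕ → Ω → EuclideanSpace ℝ (Fin l), p.IsAdmissible μ W N X₀ U →
              p.cost μ W N X₀ U ≤
                δ + ∑ k ∈ Finset.range N, p.stageCost μ (Xs k) (Us k) →
              ∀ ε η : ℝ, 0 < ε → 0 < η →
                (N : ℝ) - (δ + C) / α (ε ^ 2 * η) ≤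
                  (StochLQ.turnpikeCount μ (p.traj W X₀ U) Xs N ε η : ℝ) := by
  have hp : p.IsConvex := ⟨hQ₁, hQ₂, hR₁, hR₂⟩
  have hWlaw : ∀ k, HasLaw (W k) (μ.map (W 0)) μ := fun k =>
    ⟨(hWmeas k).aemeasurable, (hWident k).map_eq⟩
  have := (hWlaw 0).isProbabilityMeasure_iff.1 ‹_›
  obtain ⟨C⟩ := hp.nonempty_certificate hstab hdet hsteady
  obtain ⟨ϱ, hprob, hϱ, hmean, hstat⟩ := C.exists_isStationaryLaw hp
    ((memLp_iff_memLp_id_of_hasLaw (hWlaw 0)).1 (hWL2 0)) (hWlaw 0).integral_eq.symm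
  refine ⟨C.P, C.xe, C.ue, ϱ, fun r => C.c * r, C.isRiccatiSolution, C.isOptimalSteadyState hp,
    isP2_of_memLp HasLaw.id hϱ, isKInfty_const_mul C.storage.rate_pos, ?_, fun Xs Us hsol => ?_⟩
  · rintro ⟨ξ, hξ, hξW⟩
    exact exists_isFeedbackSolution hWmeas hWindep ϱ hξ hξW
  have hlaw := hsol.hasLaw hWlaw hstat
  have hdiss := C.isStrictlyDissipativeWith hp hsol hlaw hϱ hmean hWL2
    fun k => (hWident k).integral_eq
  refine ⟨hsol.isStationaryPair hlaw hϱ, hdiss, fun X₀ hX₀ => ?_⟩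
  obtain ⟨D, hD⟩ := hdiss.exists_turnpike hWL2
    (fun k => (memLp_iff_memLp_id_of_hasLaw (hlaw k)).2 hϱ) hX₀
  exact ⟨D, fun N δ _ => hD N δ⟩
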